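/- Let $n\ge 2$, let $F_n$ be the free group on $a_1,\dots,a_n$, let $\sigma_n\in \mathrm{Aut}(F_n)$ be the involution $a_i\mapsto a_i^{-1}$, and let $\Pi A(F_n)\le \mathrm{Aut}(F_n)$ be the palindromic automorphism group, i.e. the group of all automorphisms that send every $a_i$ to a palindrome (a reduced word equal to its reverse); it is the centralizer of $\sigma_n$. Let $X_n$ be the spine of auter space: the simplicial complex of chains in the poset of equivalence classes of marked graphs of rank $n$, i.e. finite connected pointed graphs $\Gamma$ without separating edges, with basepoint of valence at least $2$ and all other vertices of valence at least $3$, together with an isomorphism $F_n\cong\pi_1(\Gamma,*)$, ordered by collapsing of subforests. $\mathrm{Aut}(F_n)$ acts on $X_n$ by changing the marking. Let $L_{\sigma_n}\subseteq X_n$ be the full subcomplex spanned by the marked graphs that are fixed by $\sigma_n$ and essential, i.e. no edge of the graph lies in every maximal $\sigma_n$-invariant subforest for the induced action of $\sigma_n$ on the graph. The group $\Pi A(F_n)$ acts on $L_{\sigma_n}$; let $Q_{\sigma_n}=L_{\sigma_n}/\Pi A(F_n)$ be the quotient, a complex whose simplices are the orbits of the simplices of $L_{\sigma_n}$ and whose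 cohomology is computed by the corresponding cellular cochain complex. Then for every odd prime $p$ the top-dimensional cohomology of $Q_{\sigma_n}$ with coefficients in $\mathbb{Z}_{(p)}$ (the localization of $\mathbb{Z}$ at the prime ideal $(p)$) vanishes: $$H^{n-1}(Q_{\sigma_n};\mathbb{Z}_{(p)})=0.$$ -/

import Mathlib

namespace PalAut

/-! ### Finite pointed graphs -/

/-- A finite pointed graph (in the sense of Serre): `src d` is the initial vertex of the oriented
edge `d`, and `rev d` is `d` with the opposite orientation.  An unoriented edge is a pair
`{d, rev d}`; loops and multiple edges are allowed. -/
structure PGraph where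
  V : Type
  D : Type
  finV : Finite V
  finD : Finite D
  src : D → V
  rev : D → D
  rev_rev : ∀ d, rev (rev d) = d
  rev_ne : ∀ d, rev d ≠ d
  base : V

namespace PGraph

variable (Γ : PGraph)

/-- The terminal vertex of an oriented edge. -/
def tgt (d : Γ.D) : Γ.V := Γ.src (Γ.rev d)

/-- `Γ.IsPath u l v`: the list `l` of oriented edges is an edge path from `u` to `v`. -/
def IsPath : Γ.V → List Γ.D → Γ.V → Prop
  | u, [], v => u = v
  | u, d :: l, v => Γ.src d = u ∧ IsPath (Γ.tgt d) l v

/-- The vertices `u` and `v` are joined by an edge path all of whose edges lie in `F`. -/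
def Joined (F : Set Γ.D) (u v : Γ.V) : Prop :=
  ∃ l, Γ.IsPath u l v ∧ ∀ d ∈ l, d ∈ F

/-- An edge path without backtracking. -/
def IsTaut (l : List Γ.D) : Prop := l.IsChain (fun d d' => d' ≠ Γ.rev d)

/-- A subforest, as a set of edges (a set of oriented edges closed under reversal): it carries
no nonempty closed edge path without backtracking. -/
def IsForest (F : Set Γ.D) : Prop :=
  (∀ d ∈ F, Γ.rev d ∈ F) ∧
    ∀ u l, Γ.IsPath u l u → Γ.IsTaut l → (∀ d ∈ l, d ∈ F) → l = []

/-- The number of oriented edges starting at `v`. -/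
noncomputable def valence (v : Γ.V) : ℕ := Nat.card {d : Γ.D // Γ.src d = v}

/-- Connected, without separating edges, the basepoint has valence at least `2`, and all other
vertices have valence at least `3`. -/
structure IsAdmissible : Prop where
  connected : ∀ u v, Γ.Joined Set.univ u v
  noSeparatingEdge : ∀ d, Γ.Joined {d' | d' ≠ d ∧ d' ≠ Γ.rev d} (Γ.src d) (Γ.tgt d)
  valence_base : 2 ≤ Γ.valence Γ.base
  valence_ne_base : ∀ v, v ≠ Γ.base → 3 ≤ Γ.valence v

/-! ### The fundamental group -/

/-- The group generated by the oriented edges, with `rev d` inverse to `d`. -/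
abbrev PathGroup : Type := PresentedGroup {w : FreeGroup Γ.D |
  ∃ d, w = FreeGroup.of d * FreeGroup.of (Γ.rev d)}

/-- The class of an oriented edge. -/
def edge (d : Γ.D) : Γ.PathGroup := PresentedGroup.of d

lemma edge_mul_edge_rev (d : Γ.D) : Γ.edge d * Γ.edge (Γ.rev d) = 1 :=
  PresentedGroup.one_of_mem ⟨d, rfl⟩

/-- The homomorphism out of the path group with prescribed values on the edges. -/
def liftEdges {G : Type*} [Group G] (f : Γ.D → G) (hf : ∀ d, f d * f (Γ.rev d) = 1) :
    Γ.PathGroup →* G :=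
  PresentedGroup.toGroup (f := f) (by rintro _ ⟨d, rfl⟩; simpa using hf d)

@[simp] lemma liftEdges_edge {G : Type*} [Group G] (f : Γ.D → G)
    (hf : ∀ d, f d * f (Γ.rev d) = 1) (d : Γ.D) : Γ.liftEdges f hf (Γ.edge d) = f d :=
  PresentedGroup.toGroup.of _

/-- The class of an edge path: the product of the classes of its edges. -/
def pathClass (l : List Γ.D) : Γ.PathGroup := (l.map Γ.edge).prod

variable {Γ} in
lemma IsPath.append {u v w : Γ.V} {l l' : List Γ.D} (h : Γ.IsPath u l v) (h' : Γ.IsPath v l' w) :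
    Γ.IsPath u (l ++ l') w := by
  induction l generalizing u with
  | nil => cases h; exact h'
  | cons d l ih => exact ⟨h.1, ih h.2⟩

variable {Γ} in
lemma IsPath.reverse {u v : Γ.V} {l : List Γ.D} (h : Γ.IsPath u l v) :
    Γ.IsPath v (l.map Γ.rev).reverse u := by
  induction l generalizing u with
  | nil => cases h; rfl
  | cons d l ih =>
    rw [List.map_cons, List.reverse_cons]
    refine (ih h.2).append ⟨rfl, ?_⟩
    rw [tgt, Γ.rev_rev]
    exact h.1

lemma edge_rev (d : Γ.D) : Γ.edge (Γ.rev d) = (Γ.edge d)⁻¹ :=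
  (inv_eq_of_mul_eq_one_right (Γ.edge_mul_edge_rev d)).symm

lemma pathClass_reverse (l : List Γ.D) :
    Γ.pathClass (l.map Γ.rev).reverse = (Γ.pathClass l)⁻¹ := by
  induction l with
  | nil => simp [pathClass]
  | cons d l ih =>
    simp only [pathClass, List.map_cons, List.reverse_cons, List.map_append, List.prod_append,
      List.map_nil, List.prod_cons, List.prod_nil, mul_one, mul_inv_rev, edge_rev] at ih ⊢
    rw [ih]

/-- The fundamental group `π₁(Γ, *)`: the classes of the closed edge paths at the basepoint.
(The path group is free on the unoriented edges, so that two closed edge paths have the same class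
exactly when they differ by inserting and deleting backtracks, that is, when they are homotopic.) -/
def pi1 : Subgroup Γ.PathGroup where
  carrier := {w | ∃ l, Γ.IsPath Γ.base l Γ.base ∧ Γ.pathClass l = w}
  one_mem' := ⟨[], rfl, rfl⟩
  mul_mem' := by
    rintro _ _ ⟨l, hl, rfl⟩ ⟨l', hl', rfl⟩
    exact ⟨l ++ l', hl.append hl', by simp [pathClass]⟩
  inv_mem' := by
    rintro _ ⟨l, hl, rfl⟩
    exact ⟨_, hl.reverse, Γ.pathClass_reverse l⟩

end PGraph

/-! ### Isomorphisms and forest collapses -/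

/-- An isomorphism of pointed graphs. -/
structure GraphIso (Γ Γ' : PGraph) where
  onV : Γ.V ≃ Γ'.V
  onD : Γ.D ≃ Γ'.D
  map_src : ∀ d, Γ'.src (onD d) = onV (Γ.src d)
  map_rev : ∀ d, Γ'.rev (onD d) = onD (Γ.rev d)
  map_base : onV Γ.base = Γ'.base

namespace GraphIso

variable {Γ Γ' Γ'' : PGraph}

/-- The identity. -/
def refl (Γ : PGraph) : GraphIso Γ Γ :=
  ⟨Equiv.refl _, Equiv.refl _, fun _ => rfl, fun _ => rfl, rfl⟩

/-- The inverse. -/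
def symm (h : GraphIso Γ Γ') : GraphIso Γ' Γ where
  onV := h.onV.symm
  onD := h.onD.symm
  map_src d := by
    rw [Equiv.eq_symm_apply, ← h.map_src, Equiv.apply_symm_apply]
  map_rev d := by
    rw [Equiv.eq_symm_apply, ← h.map_rev, Equiv.apply_symm_apply]
  map_base := by rw [Equiv.symm_apply_eq, h.map_base]

/-- The composition. -/
def trans (h : GraphIso Γ Γ') (h' : GraphIso Γ' Γ'') : GraphIso Γ Γ'' where
  onV := h.onV.trans h'.onV
  onD := h.onD.trans h'.onD
  map_src d := by simp [h.map_src, h'.map_src]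
  map_rev d := by simp [h.map_rev, h'.map_rev]
  map_base := by simp [h.map_base, h'.map_base]

/-- The induced homomorphism of path groups. -/
def map (h : GraphIso Γ Γ') : Γ.PathGroup →* Γ'.PathGroup :=
  Γ.liftEdges (fun d => Γ'.edge (h.onD d)) fun d => by
    rw [← h.map_rev]; exact Γ'.edge_mul_edge_rev _

lemma map_refl (w : Γ.PathGroup) : (refl Γ).map w = w := by
  have : (refl Γ).map = MonoidHom.id _ := PresentedGroup.ext fun d => Γ.liftEdges_edge _ _ d
  rw [this]; rfl

lemma map_trans (h : GraphIso Γ Γ') (h' : GraphIso Γ' Γ'') (w : Γ.PathGroup) :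
    (h.trans h').map w = h'.map (h.map w) := by
  have : (h.trans h').map = h'.map.comp h.map := PresentedGroup.ext fun d => by
    change (h.trans h').map (Γ.edge d) = h'.map (h.map (Γ.edge d))
    simp [map, trans]
  rw [this]; rfl

lemma map_symm_map (h : GraphIso Γ Γ') (w : Γ.PathGroup) : h.symm.map (h.map w) = w := by
  have : h.symm.map.comp h.map = MonoidHom.id _ := PresentedGroup.ext fun d => by
    change h.symm.map (h.map (Γ.edge d)) = Γ.edge d
    simp [map, symm]
  exact DFunLike.congr_fun this w

end GraphIso

/-- A forest collapse `Γ → Γ'`, that is, an identification of `Γ'` with the quotient of `Γ` by a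
subforest.  The edges `d` with `onD d = none` are those of the forest; the other ones are in
bijection with the edges of `Γ'`, and the vertices of `Γ'` are the vertices of `Γ` up to
being joined in the forest. -/
structure Collapse (Γ Γ' : PGraph) where
  onV : Γ.V → Γ'.V
  onD : Γ.D → Option Γ'.D
  map_rev : ∀ d, onD (Γ.rev d) = (onD d).map Γ'.rev
  map_src : ∀ d d', onD d = some d' → Γ'.src d' = onV (Γ.src d)
  map_base : onV Γ.base = Γ'.base
  bijOn_edges : ∀ d', ∃! d, onD d = some d'
  surjective_onV : Function.Surjective onV
  onV_eq_iff : ∀ u v, onV u = onV v ↔ Γ.Joined {d | onD d = none} u v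
  isForest : Γ.IsForest {d | onD d = none}

namespace Collapse

variable {Γ Γ' : PGraph}

/-- The induced homomorphism of path groups: the edges of the forest are sent to `1`. -/
def map (c : Collapse Γ Γ') : Γ.PathGroup →* Γ'.PathGroup :=
  Γ.liftEdges (fun d => (c.onD d).elim 1 Γ'.edge) fun d => by
    rw [c.map_rev]
    cases c.onD d with
    | none => simp
    | some d' => exact Γ'.edge_mul_edge_rev d'

end Collapse

/-! ### Marked graphs and the spine of auter space -/

/-- A marked graph of rank `n`: an admissible graph with an isomorphism `F_n ≅ π₁(Γ, *)`
(equivalently, a pointed homotopy equivalence from the rose up to pointed homotopy). -/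
structure MarkedGraph (n : ℕ) where
  graph : PGraph
  admissible : graph.IsAdmissible
  mark : FreeGroup (Fin n) ≃* graph.pi1

/-- Two marked graphs are equivalent if an isomorphism of pointed graphs takes one marking to
the other. -/
def MarkedGraph.Equivalent {n : ℕ} (M N : MarkedGraph n) : Prop :=
  ∃ h : GraphIso M.graph N.graph, ∀ w, h.map (M.mark w) = N.mark w

instance markedGraphSetoid (n : ℕ) : Setoid (MarkedGraph n) where
  r := MarkedGraph.Equivalent
  iseqv :=
    { refl := fun M => ⟨GraphIso.refl _, fun _ => GraphIso.map_refl _⟩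
      symm := by
        rintro M N ⟨h, hh⟩
        exact ⟨h.symm, fun w => by rw [← hh, h.map_symm_map]⟩
      trans := by
        rintro M N P ⟨h, hh⟩ ⟨k, hk⟩
        exact ⟨h.trans k, fun w => by rw [h.map_trans, hh, hk]⟩ }

/-- The vertices of the spine `X_n` of auter space: the equivalence classes of marked graphs. -/
def Spine (n : ℕ) : Type 1 := Quotient (markedGraphSetoid n)

/-- The class of a marked graph. -/
def MarkedGraph.toSpine {n : ℕ} (M : MarkedGraph n) : Spine n := Quotient.mk _ M

/-- The strict order on the vertices of the spine: `x < y` if `x` is obtained from `y` by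
collapsing a nonempty subforest. -/
def Spine.Below {n : ℕ} (x y : Spine n) : Prop :=
  ∃ M N : MarkedGraph n, M.toSpine = x ∧ N.toSpine = y ∧
    ∃ c : Collapse N.graph M.graph, (∃ d, c.onD d = none) ∧
      ∀ w, c.map (N.mark w) = M.mark w

/-- The change of marking `φ ↦ φ ∘ g⁻¹` by an automorphism `g` of `F_n`. -/
def MarkedGraph.twist {n : ℕ} (g : MulAut (FreeGroup (Fin n))) (M : MarkedGraph n) :
    MarkedGraph n where
  graph := M.graph
  admissible := M.admissible
  mark := (MulEquiv.symm g).trans M.mark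

lemma MarkedGraph.twist_mark {n : ℕ} (g : MulAut (FreeGroup (Fin n))) (M : MarkedGraph n)
    (w : FreeGroup (Fin n)) : (M.twist g).mark w = M.mark (g⁻¹ w) := rfl

/-- The action of `Aut(F_n)` on the spine. -/
instance (n : ℕ) : MulAction (MulAut (FreeGroup (Fin n))) (Spine n) where
  smul g := Quotient.map (MarkedGraph.twist g) (by
    rintro M N ⟨h, hh⟩
    exact ⟨h, fun w => hh (g⁻¹ w)⟩)
  one_smul := by
    rintro ⟨M⟩
    rfl
  mul_smul := by
    rintro g h ⟨M⟩
    rfl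

lemma smul_toSpine {n : ℕ} (g : MulAut (FreeGroup (Fin n))) (M : MarkedGraph n) :
    g • M.toSpine = (M.twist g).toSpine := rfl

/-! ### The involution and the palindromic automorphism group -/

/-- The automorphism `σ_n` of `F_n` that sends each generator to its inverse. -/
def sigma (n : ℕ) : MulAut (FreeGroup (Fin n)) :=
  MonoidHom.toMulEquiv (FreeGroup.lift fun i => (FreeGroup.of i)⁻¹)
    (FreeGroup.lift fun i => (FreeGroup.of i)⁻¹)
    (by ext i; simp) (by ext i; simp)

@[simp] lemma sigma_of {n : ℕ} (i : Fin n) : sigma n (FreeGroup.of i) = (FreeGroup.of i)⁻¹ := by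
  simp [sigma]

/-- The reduced word of `x` is equal to its reverse. -/
def IsPalindrome {n : ℕ} (x : FreeGroup (Fin n)) : Prop := x.toWord.reverse = x.toWord

lemma sigma_mk {n : ℕ} (L : List (Fin n × Bool)) :
    (sigma n (FreeGroup.mk L))⁻¹ = FreeGroup.mk L.reverse := by
  have key : sigma n (FreeGroup.mk L) = FreeGroup.mk (L.map fun x => (x.1, !x.2)) := by
    induction L with
    | nil => exact map_one _
    | cons a L ih =>
      obtain ⟨i, b⟩ := a
      have h : FreeGroup.mk ((i, b) :: L) = FreeGroup.mk [(i, b)] * FreeGroup.mk L := by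
        rw [FreeGroup.mul_mk]; rfl
      have h' : sigma n (FreeGroup.mk [(i, b)]) = FreeGroup.mk [(i, !b)] := by
        cases b
        · have : (FreeGroup.mk [(i, false)] : FreeGroup (Fin n)) = (FreeGroup.of i)⁻¹ := rfl
          rw [this, map_inv, sigma_of, inv_inv]; rfl
        · exact sigma_of i
      rw [h, map_mul, ih, h', FreeGroup.mul_mk]
      rfl
  rw [key, FreeGroup.inv_mk]
  congr 1
  simp [FreeGroup.invRev, Function.comp_def]

lemma isPalindrome_iff {n : ℕ} (x : FreeGroup (Fin n)) :
    IsPalindrome x ↔ sigma n x = x⁻¹ := by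
  have h1 : (sigma n x)⁻¹ = FreeGroup.mk x.toWord.reverse := by
    rw [← sigma_mk, FreeGroup.mk_toWord]
  have hred : FreeGroup.IsReduced x.toWord.reverse := by
    have := FreeGroup.isReduced_toWord (x := x)
    unfold FreeGroup.IsReduced at this ⊢
    rw [List.isChain_reverse]
    exact this.imp fun a b h h' => (h h'.symm).symm
  constructor
  · intro h
    rw [h, FreeGroup.mk_toWord] at h1
    exact inv_eq_iff_eq_inv.1 h1
  · intro h
    rw [h, inv_inv] at h1
    unfold IsPalindrome
    conv_rhs => rw [h1]
    rw [FreeGroup.toWord_mk, hred.reduce_eq]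

lemma forall_isPalindrome_iff {n : ℕ} (g : MulAut (FreeGroup (Fin n))) :
    (∀ i, IsPalindrome (g (FreeGroup.of i))) ↔ sigma n * g = g * sigma n := by
  simp only [isPalindrome_iff]
  constructor
  · intro h
    have : (sigma n * g : MulAut _).toMonoidHom = (g * sigma n : MulAut _).toMonoidHom := by
      ext i
      simpa using h i
    ext x
    exact DFunLike.congr_fun this x
  · intro h i
    have := DFunLike.congr_fun h (FreeGroup.of i)
    simpa using this

/-- The palindromic automorphism group `ΠA(F_n)`: the automorphisms that send every generator to
a palindrome. -/
def PiA (n : ℕ) : Subgroup (MulAut (FreeGroup (Fin n))) where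
  carrier := {g | ∀ i, IsPalindrome (g (FreeGroup.of i))}
  one_mem' := (forall_isPalindrome_iff 1).2 (by simp)
  mul_mem' := by
    intro g h hg hh
    rw [Set.mem_ofPred_eq, forall_isPalindrome_iff] at *
    rw [← mul_assoc, hg, mul_assoc, hh, mul_assoc]
  inv_mem' := by
    intro g hg
    rw [Set.mem_ofPred_eq, forall_isPalindrome_iff] at *
    rw [eq_inv_mul_iff_mul_eq, ← mul_assoc, ← hg, mul_assoc, mul_inv_cancel, mul_one]

lemma mem_PiA_iff {n : ℕ} {g : MulAut (FreeGroup (Fin n))} :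
    g ∈ PiA n ↔ sigma n * g = g * sigma n := forall_isPalindrome_iff g

/-! ### The complex `L_{σ_n}` and the action of `ΠA(F_n)` -/

/-- The subforest `F` is invariant under the graph automorphism `h`. -/
def IsInvariantForest {Γ : PGraph} (h : GraphIso Γ Γ) (F : Set Γ.D) : Prop :=
  Γ.IsForest F ∧ ∀ d, d ∈ F ↔ h.onD d ∈ F

/-- An edge is inessential if it lies in every maximal invariant subforest. -/
def IsInessential {Γ : PGraph} (h : GraphIso Γ Γ) (d : Γ.D) : Prop :=
  ∀ F, Maximal (IsInvariantForest h) F → d ∈ F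

/-- The automorphism `h` of the graph of `M` realizes `σ_n`, that is, corresponds to it under
the marking. -/
def Realizes {n : ℕ} (M : MarkedGraph n) (h : GraphIso M.graph M.graph) : Prop :=
  ∀ w, h.map (M.mark w) = M.mark (sigma n w)

/-- The vertices of `L_{σ_n}`: the vertices of the spine that are fixed by `σ_n` and that are
represented by marked graphs which have no inessential edges for the action of `σ_n`. -/
def LSet (n : ℕ) : Set (Spine n) :=
  {x | sigma n • x = x ∧ ∃ (M : MarkedGraph n) (h : GraphIso M.graph M.graph),
    M.toSpine = x ∧ Realizes M h ∧ ∀ d, ¬ IsInessential h d}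

/-- The type of vertices of `L_{σ_n}`. -/
abbrev LVertex (n : ℕ) : Type 1 := LSet n

lemma smul_mem_LSet {n : ℕ} (g : PiA n) {x : Spine n} (hx : x ∈ LSet n) :
    (g : MulAut (FreeGroup (Fin n))) • x ∈ LSet n := by
  obtain ⟨hfix, M, h, rfl, hr, he⟩ := hx
  have hg := mem_PiA_iff.1 g.2
  refine ⟨by rw [← mul_smul, hg, mul_smul, hfix], M.twist g, h, rfl, fun w => ?_, he⟩
  have hg' := mem_PiA_iff.1 (PiA n |>.inv_mem g.2)
  rw [MarkedGraph.twist_mark, MarkedGraph.twist_mark]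
  refine (hr _).trans ?_
  have := DFunLike.congr_fun hg' w
  exact congrArg (fun z => (M.mark z : M.graph.PathGroup)) this

/-- The action of `ΠA(F_n)` on the vertices of `L_{σ_n}`. -/
instance (n : ℕ) : MulAction (PiA n) (LVertex n) where
  smul g x := ⟨(g : MulAut (FreeGroup (Fin n))) • (x : Spine n), smul_mem_LSet g x.2⟩
  one_smul x := Subtype.ext (one_smul (MulAut (FreeGroup (Fin n))) (x : Spine n))
  mul_smul g h x := Subtype.ext (mul_smul (g : MulAut (FreeGroup (Fin n))) h (x : Spine n))

/-- The `k`-simplices of `L_{σ_n}`: the strictly increasing chains of `k + 1` vertices. -/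
def LSimplex (n k : ℕ) : Type 1 :=
  {s : Fin (k + 1) → LVertex n // ∀ i j, i < j → Spine.Below (s i : Spine n) (s j)}

/-- The `i`-th face of a simplex: omit the `i`-th vertex. -/
def LSimplex.face {n k : ℕ} (i : Fin (k + 2)) (s : LSimplex n (k + 1)) : LSimplex n k :=
  ⟨fun j => s.1 (i.succAbove j), fun _ _ h => s.2 _ _ (Fin.succAbove_lt_succAbove_iff.2 h)⟩

/-- Two simplices are in the same orbit of `ΠA(F_n)`. -/
instance lSimplexSetoid (n k : ℕ) : Setoid (LSimplex n k) where
  r s t := ∃ g : PiA n, ∀ i, g • s.1 i = t.1 i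
  iseqv :=
    { refl := fun s => ⟨1, fun i => one_smul _ _⟩
      symm := by
        rintro s t ⟨g, hg⟩
        exact ⟨g⁻¹, fun i => by rw [← hg, inv_smul_smul]⟩
      trans := by
        rintro s t u ⟨g, hg⟩ ⟨h, hh⟩
        exact ⟨h * g, fun i => by rw [mul_smul, hg, hh]⟩ }

/-! ### The quotient `Q_{σ_n} = L_{σ_n} / ΠA(F_n)` and its cohomology

The action preserves the order of the vertices of a simplex, so that a group element which maps
a simplex to itself fixes it pointwise.  Hence the quotient space is a `Δ`-complex whose simplices
are the orbits of the simplices of `L_{σ_n}`, and its cohomology is that of the cellular cochain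
complex below. -/

/-- The `k`-simplices of the quotient `Q_{σ_n}`. -/
def QSimplex (n k : ℕ) : Type 1 := Quotient (lSimplexSetoid n k)

/-- The faces of a simplex of `Q_{σ_n}`. -/
def QSimplex.face {n k : ℕ} (i : Fin (k + 2)) : QSimplex n (k + 1) → QSimplex n k :=
  Quotient.map (LSimplex.face i) (by
    rintro s t ⟨g, hg⟩
    exact ⟨g, fun j => hg _⟩)

lemma QSimplex.face_face {n k : ℕ} {i j : Fin (k + 2)} (h : i ≤ j) (s : QSimplex n (k + 2)) :
    (s.face i.castSucc).face j = (s.face j.succ).face i := by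
  obtain ⟨s⟩ := s
  refine congrArg (Quotient.mk (lSimplexSetoid n k)) (Subtype.ext (funext fun l => ?_))
  refine congrArg s.1 (Fin.ext ?_)
  simp only [Fin.succAbove, Fin.lt_def, Fin.le_def] at *
  split_ifs <;> simp_all <;> omega

section Cohomology

variable (n : ℕ) (R : Type) [CommRing R]

/-- The coboundary `(δ c)(s) = ∑ i, (-1) ^ i • c (∂_i s)` on the cochains of `Q_{σ_n}`. -/
def coboundary (k : ℕ) : (QSimplex n k → R) →ₗ[R] (QSimplex n (k + 1) → R) where
  toFun c s := ∑ i : Fin (k + 2), (-1) ^ (i : ℕ) * c (s.face i)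
  map_add' c c' := by
    ext s
    simp [mul_add, Finset.sum_add_distrib]
  map_smul' a c := by
    ext s
    simp [Finset.mul_sum, mul_left_comm]

lemma coboundary_coboundary (k : ℕ) (c : QSimplex n k → R) :
    coboundary n R (k + 1) (coboundary n R k c) = 0 := by
  ext s
  simp only [coboundary, LinearMap.coe_mk, AddHom.coe_mk, Finset.mul_sum, Pi.zero_apply]
  rw [← Finset.sum_product', Finset.univ_product_univ,
    ← Finset.sum_filter_add_sum_filter_not _
      (fun x : Fin (k + 3) × Fin (k + 2) => x.1 ≤ x.2.castSucc), ← eq_neg_iff_add_eq_zero,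
    ← Finset.sum_neg_distrib]
  refine Finset.sum_bij'
    (fun x hx => (x.2.succ, x.1.castLT (lt_of_le_of_lt (Fin.le_def.1 (Finset.mem_filter.1 hx).2)
      x.2.isLt)))
    (fun x hx => (x.2.castSucc, x.1.pred (fun h0 => (Finset.mem_filter.1 hx).2
      (h0 ▸ Fin.zero_le _)))) ?_ ?_ ?_ ?_ ?_
  · rintro ⟨a, b⟩ hx
    simp only [Finset.mem_filter, Finset.mem_univ, true_and, Fin.le_def, Fin.val_succ,
      Fin.val_castSucc, Fin.val_castLT] at hx ⊢
    omega
  · rintro ⟨a, b⟩ hx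
    simp only [Finset.mem_filter, Finset.mem_univ, true_and, Fin.le_def,
      Fin.val_castSucc, Fin.val_pred] at hx ⊢
    omega
  · rintro ⟨a, b⟩ hx
    simp
  · rintro ⟨a, b⟩ hx
    simp
  · rintro ⟨a, b⟩ hx
    have hab : a.castLT (lt_of_le_of_lt (Fin.le_def.1 (Finset.mem_filter.1 hx).2) b.isLt) ≤ b :=
      Fin.le_def.2 (Finset.mem_filter.1 hx).2
    have key := QSimplex.face_face hab s
    rw [Fin.castSucc_castLT] at key
    simp only [key, Fin.val_succ, Fin.val_castLT]
    ring

/-- The coboundaries of degree `k`. -/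
def coboundaries : (k : ℕ) → Submodule R (QSimplex n k → R)
  | 0 => ⊥
  | k + 1 => LinearMap.range (coboundary n R k)

/-- The cohomology group `H^k(Q_{σ_n}; R)`: cocycles modulo coboundaries. -/
abbrev QCohomology (k : ℕ) : Type 1 :=
  LinearMap.ker (coboundary n R k) ⧸
    (coboundaries n R k).submoduleOf (LinearMap.ker (coboundary n R k))

end Cohomology

/-! ### The coefficients -/

instance isPrime_span (p : ℕ) [hp : Fact p.Prime] : (Ideal.span {(p : ℤ)}).IsPrime :=
  Ideal.isPrime_span_singleton_of_prime (Nat.prime_iff_prime_int.1 hp.out)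

/-- The ring `ℤ_(p)`: the localization of `ℤ` at the prime ideal `(p)`. -/
abbrev ZLocal (p : ℕ) [Fact p.Prime] : Type := Localization.AtPrime (Ideal.span {(p : ℤ)})

end PalAut

/-!
# The top cohomology of the quotient of `L_{σ_n}` vanishes

**Graphs with involution and trees.**  If `h` is the automorphism of a marked graph `Γ` that
realizes `σ_n`, then `h` acts by `-1` on the first homology, so an `h`-invariant cochain vanishes on
the fundamental group (`Realizes.sum_eq_zero`).  Geometrically, `Γ / h` is a tree `T`, and `Γ`
consists of two copies of `T` glued at `n + 1` branch points; these are the fixed vertices, one of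
which is the base, and the midpoints of the flipped edges.  A simplex of the quotient `Q_{σ_n}` is a
tree `T` together with a chain of subforests that have at most one branch point in each component.
In the top dimension `n - 1` all branch points are leaves of `T`, the other vertices of `T` are
trivalent (`IsTrivalent`), and the chain collapses one edge of `T` at a time until only branch
points are left.  Here the rank of a vertex of `L_{σ_n}` is the number of vertices of `Γ` that are
moved by `h`, that is, twice the number of vertices of `T` that are not branch points; it grows by
at least two in every step of a chain (`numMoved_add_two_le`) and is at most `2 n - 2` by an Euler
characteristic count (`IsAdmissible.numMoved_empty_le`), so a top simplex has the ranks
`0, 2, …, 2 n - 2`.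

**The cochains.**  The collapse to the vertex of rank `0` must at some point involve an edge of `T`
adjacent to a leaf (`leafBelow_of_rank_eq_zero`).  Match a top simplex with its face opposite to the
last vertex of the chain that comes before such a leaf edge.  If another top simplex has the same
face, there are two cases.  If that vertex is not the top vertex, then either the two edges around it
are collapsed in the other order, so that the leaf edge comes earlier, or the two simplices are equal
(`eq_of_leafBelow`).  If it is the top vertex, then its tree is recovered from the next one by
pulling a branch point of valence two off the tree, which can be done in one way only; on the level
of graphs the different ways to do so differ by the involution on a branch, which is realized by a
palindromic automorphism (`exists_PiA_of_leafEdge`).  Hence the matrix of the coboundary is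
triangular on the matched faces, and the coboundary is surjective, over any ring of coefficients
(`coboundary_surjective`).

**Rigidity.**  That the involution and the collapses are well defined on the classes of
marked graphs follows from the fact that a collapse of an admissible graph is determined by its
effect on the fundamental group (`Collapse.onD_eq_of_map_eq`), which is proved with the normal form
of the elements of the path group by edge paths without backtracking.
-/

namespace PalAut

namespace PGraph

variable {Γ : PGraph}

/-! ### Edge paths and reduced edge paths -/

lemma tgt_rev (d : Γ.D) : Γ.tgt (Γ.rev d) = Γ.src d := by rw [tgt, Γ.rev_rev]

lemma rev_injective : Function.Injective Γ.rev := fun a b h => by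
  rw [← Γ.rev_rev a, h, Γ.rev_rev]

lemma isPath_append_iff {u w : Γ.V} {l l' : List Γ.D} :
    Γ.IsPath u (l ++ l') w ↔ ∃ v, Γ.IsPath u l v ∧ Γ.IsPath v l' w := by
  induction l generalizing u with
  | nil => exact ⟨fun h => ⟨u, rfl, h⟩, fun ⟨v, h, h'⟩ => by cases h; exact h'⟩
  | cons d l ih =>
    rw [List.cons_append, IsPath, ih]
    exact ⟨fun ⟨h, v, h1, h2⟩ => ⟨v, ⟨h, h1⟩, h2⟩, fun ⟨v, ⟨h, h1⟩, h2⟩ => ⟨h, v, h1, h2⟩⟩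

lemma IsPath.end_unique {u v v' : Γ.V} {l : List Γ.D} (h : Γ.IsPath u l v)
    (h' : Γ.IsPath u l v') : v = v' := by
  induction l generalizing u with
  | nil => exact (Eq.symm h).trans h'
  | cons d l ih => exact ih h.2 h'.2

lemma IsPath.singleton (d : Γ.D) : Γ.IsPath (Γ.src d) [d] (Γ.tgt d) := ⟨rfl, rfl⟩

lemma Joined.refl (F : Set Γ.D) (u : Γ.V) : Γ.Joined F u u := ⟨[], rfl, by simp⟩

lemma Joined.trans {F : Set Γ.D} {u v w : Γ.V} (h : Γ.Joined F u v) (h' : Γ.Joined F v w) :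
    Γ.Joined F u w := by
  obtain ⟨l, hl, hF⟩ := h
  obtain ⟨l', hl', hF'⟩ := h'
  exact ⟨l ++ l', hl.append hl', by simpa [or_imp, forall_and] using ⟨hF, hF'⟩⟩

lemma Joined.symm {F : Set Γ.D} (hF : ∀ d ∈ F, Γ.rev d ∈ F) {u v : Γ.V} (h : Γ.Joined F u v) :
    Γ.Joined F v u := by
  obtain ⟨l, hl, h⟩ := h
  refine ⟨_, hl.reverse, fun d hd => ?_⟩
  obtain ⟨e, he, rfl⟩ := List.mem_map.1 (List.mem_reverse.1 hd)
  exact hF _ (h e he)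

lemma Joined.mono {F G : Set Γ.D} (hFG : F ⊆ G) {u v : Γ.V} (h : Γ.Joined F u v) :
    Γ.Joined G u v := by
  obtain ⟨l, hl, h⟩ := h
  exact ⟨l, hl, fun d hd => hFG (h d hd)⟩

lemma Joined.edge {F : Set Γ.D} {d : Γ.D} (hd : d ∈ F) : Γ.Joined F (Γ.src d) (Γ.tgt d) :=
  ⟨[d], IsPath.singleton d, by simpa using hd⟩

/-- A subset of the vertices that is closed under the edges of `F` contains the `F`-component of
each of its elements. -/
lemma Joined.mem_of_closed {F : Set Γ.D} {S : Set Γ.V}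
    (hS : ∀ d ∈ F, Γ.src d ∈ S → Γ.tgt d ∈ S) {u v : Γ.V} (h : Γ.Joined F u v) (hu : u ∈ S) :
    v ∈ S := by
  obtain ⟨l, hl, h⟩ := h
  induction l generalizing u with
  | nil => cases hl; exact hu
  | cons d l ih =>
    obtain ⟨rfl, hl⟩ := hl
    exact ih (hS d (h d (by simp)) hu) hl fun e he => h e (by simp [he])

lemma joined_empty_iff {u v : Γ.V} : Γ.Joined ∅ u v ↔ u = v := by
  refine ⟨fun ⟨l, hl, h⟩ => ?_, fun h => h ▸ Joined.refl _ _⟩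
  cases l with
  | nil => exact hl
  | cons d l => exact absurd (h d (by simp)) (by simp)

lemma isTaut_nil : Γ.IsTaut [] := List.isChain_nil

lemma isTaut_singleton (d : Γ.D) : Γ.IsTaut [d] := List.isChain_singleton d

lemma IsTaut.reverse {l : List Γ.D} (h : Γ.IsTaut l) : Γ.IsTaut (l.map Γ.rev).reverse := by
  unfold IsTaut at *
  rw [List.isChain_reverse, List.isChain_map]
  refine h.imp fun a b hab h' => hab ?_
  rw [h', Γ.rev_rev]

/-- Every edge path can be made taut by deleting backtracks. -/
lemma exists_isTaut {u v : Γ.V} {l : List Γ.D} (h : Γ.IsPath u l v) :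
    ∃ l', Γ.IsPath u l' v ∧ Γ.IsTaut l' ∧ ∀ d ∈ l', d ∈ l := by
  induction l generalizing u with
  | nil => exact ⟨[], h, isTaut_nil, by simp⟩
  | cons d l ih =>
    obtain ⟨rfl, hl⟩ := h
    obtain ⟨l', hl', ht, hsub⟩ := ih hl
    cases l' with
    | nil => exact ⟨[d], ⟨rfl, hl'⟩, isTaut_singleton d, by simp⟩
    | cons e l' =>
      by_cases he : e = Γ.rev d
      · subst he
        refine ⟨l', by simpa [tgt_rev] using hl'.2, ht.tail, fun x hx => ?_⟩
        exact List.mem_cons_of_mem _ (hsub x (by simp [hx]))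
      · refine ⟨d :: e :: l', ⟨rfl, hl'⟩, List.isChain_cons_cons.2 ⟨he, ht⟩, fun x hx => ?_⟩
        rcases List.mem_cons.1 hx with rfl | hx
        · simp
        · exact List.mem_cons_of_mem _ (hsub x hx)

lemma Joined.exists_isTaut {F : Set Γ.D} {u v : Γ.V} (h : Γ.Joined F u v) :
    ∃ l, Γ.IsPath u l v ∧ Γ.IsTaut l ∧ ∀ d ∈ l, d ∈ F := by
  obtain ⟨l, hl, h⟩ := h
  obtain ⟨l', hl', ht, hs⟩ := PGraph.exists_isTaut hl
  exact ⟨l', hl', ht, fun d hd => h d (hs d hd)⟩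

lemma IsForest.src_ne_tgt {F : Set Γ.D} (hF : Γ.IsForest F) {d : Γ.D} (hd : d ∈ F) :
    Γ.src d ≠ Γ.tgt d := fun h => by
  simpa using hF.2 (Γ.src d) [d] ⟨rfl, h.symm⟩ (isTaut_singleton d) (by simpa using hd)

/-- In a connected graph without separating edges, an edge does not disconnect two vertices. -/
lemma IsAdmissible.joined_compl (hΓ : Γ.IsAdmissible) (d : Γ.D) (u v : Γ.V) :
    Γ.Joined {d' | d' ≠ d ∧ d' ≠ Γ.rev d} u v := by
  obtain ⟨l, hl, -⟩ := hΓ.connected u v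
  have hsep := hΓ.noSeparatingEdge d
  induction l generalizing u with
  | nil => cases hl; exact Joined.refl _ _
  | cons e l ih =>
    obtain ⟨rfl, hl⟩ := hl
    refine Joined.trans ?_ (ih _ hl)
    by_cases h1 : e = d
    · subst h1; exact hsep
    by_cases h2 : e = Γ.rev d
    · subst h2
      rw [tgt_rev]
      refine Joined.symm ?_ hsep
      intro x hx
      exact ⟨fun h => hx.2 (by rw [← h, Γ.rev_rev]), fun h => hx.1 (rev_injective h)⟩
    exact Joined.edge ⟨h1, h2⟩

lemma IsAdmissible.exists_return (hΓ : Γ.IsAdmissible) (d : Γ.D) :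
    ∃ q, Γ.IsPath (Γ.tgt d) q Γ.base ∧ Γ.IsTaut (d :: q) := by
  obtain ⟨q, hq, ht, h⟩ := (hΓ.joined_compl d (Γ.tgt d) Γ.base).exists_isTaut
  refine ⟨q, hq, ?_⟩
  cases q with
  | nil => exact isTaut_singleton d
  | cons e q => exact List.isChain_cons_cons.2 ⟨(h e (by simp)).2, ht⟩

lemma IsAdmissible.exists_approach (hΓ : Γ.IsAdmissible) (d : Γ.D) :
    ∃ q, Γ.IsPath Γ.base q (Γ.src d) ∧ Γ.IsTaut (q ++ [d]) := by
  obtain ⟨q, hq, ht⟩ := hΓ.exists_return (Γ.rev d)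
  rw [tgt_rev] at hq
  refine ⟨_, hq.reverse, ?_⟩
  have := ht.reverse
  rwa [List.map_cons, List.reverse_cons, Γ.rev_rev] at this

/-- Joining two taut paths that overlap in an edge. -/
lemma IsTaut.append_cons {l q : List Γ.D} {d : Γ.D} (h : Γ.IsTaut (l ++ [d]))
    (h' : Γ.IsTaut (d :: q)) : Γ.IsTaut (l ++ [d] ++ q) := by
  unfold IsTaut at *
  rw [List.isChain_append]
  refine ⟨h, h'.tail, fun x hx y hy => ?_⟩
  simp only [List.getLast?_append, List.getLast?_singleton, Option.some_or, Option.mem_def,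
    Option.some.injEq] at hx
  subst hx
  cases q with
  | nil => simp at hy
  | cons e q =>
    simp only [List.head?_cons, Option.mem_def, Option.some.injEq] at hy
    subst hy
    exact (List.isChain_cons_cons.1 h').1

/-! ### Normal forms in the path group

The path group acts on the set of taut lists of edges as a free group acts on its reduced words;
the class of a taut list takes the empty list to that list. -/

open Classical in
/-- Put an edge in front of a list and cancel. -/
noncomputable def push (d : Γ.D) : List Γ.D → List Γ.D
  | [] => [d]
  | e :: l => if e = Γ.rev d then l else d :: e :: l

lemma IsTaut.push {l : List Γ.D} (h : Γ.IsTaut l) (d : Γ.D) : Γ.IsTaut (push d l) := by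
  cases l with
  | nil => exact isTaut_singleton d
  | cons e l =>
    simp only [PGraph.push]
    split_ifs with he
    · exact h.tail
    · exact List.isChain_cons_cons.2 ⟨he, h⟩

lemma push_eq_cons {l : List Γ.D} {d : Γ.D} (h : Γ.IsTaut (d :: l)) : push d l = d :: l := by
  cases l with
  | nil => rfl
  | cons e l => exact if_neg (List.isChain_cons_cons.1 h).1

lemma push_rev_push {l : List Γ.D} (h : Γ.IsTaut l) (d : Γ.D) :
    push (Γ.rev d) (push d l) = l := by
  cases l with
  | nil => simp [push, Γ.rev_rev]
  | cons e l =>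
    by_cases he : e = Γ.rev d
    · subst he
      rw [push, if_pos rfl, push_eq_cons h]
    · rw [push, if_neg he, push, if_pos (Γ.rev_rev d).symm]

/-- The permutation of the taut lists given by an edge. -/
noncomputable def pushPerm (d : Γ.D) : Equiv.Perm {l : List Γ.D // Γ.IsTaut l} where
  toFun l := ⟨push d l.1, l.2.push d⟩
  invFun l := ⟨push (Γ.rev d) l.1, l.2.push _⟩
  left_inv l := Subtype.ext (push_rev_push l.2 d)
  right_inv l := Subtype.ext (by simpa [Γ.rev_rev] using push_rev_push l.2 (Γ.rev d))

/-- The action of the path group on the taut lists. -/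
noncomputable def tautAction (Γ : PGraph) :
    Γ.PathGroup →* Equiv.Perm {l : List Γ.D // Γ.IsTaut l} :=
  Γ.liftEdges pushPerm fun d => Equiv.ext fun l => Subtype.ext (by
    simpa [Γ.rev_rev, pushPerm] using push_rev_push l.2 (Γ.rev d))

lemma pathClass_cons (d : Γ.D) (l : List Γ.D) :
    Γ.pathClass (d :: l) = Γ.edge d * Γ.pathClass l := by simp [pathClass]

lemma tautAction_pathClass {l : List Γ.D} (h : Γ.IsTaut l) :
    Γ.tautAction (Γ.pathClass l) ⟨[], isTaut_nil⟩ = ⟨l, h⟩ := by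
  induction l with
  | nil => simp [pathClass]
  | cons d l ih =>
    rw [pathClass_cons, map_mul, Equiv.Perm.mul_apply, ih h.tail]
    have : Γ.tautAction (Γ.edge d) = pushPerm d := Γ.liftEdges_edge _ _ d
    rw [this]
    exact Subtype.ext (push_eq_cons h)

/-- Taut lists of edges with the same class are equal. -/
lemma IsTaut.eq_of_pathClass_eq {l l' : List Γ.D} (h : Γ.IsTaut l) (h' : Γ.IsTaut l')
    (he : Γ.pathClass l = Γ.pathClass l') : l = l' := by
  have := tautAction_pathClass h
  rw [he, tautAction_pathClass h'] at this
  exact (congrArg Subtype.val this).symm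

end PGraph
end PalAut
namespace PalAut

open PGraph

/-! ### Collapses and edge paths -/

namespace Collapse

variable {Γ Γ' Γ'' : PGraph}

/-- The forest of a collapse, as a set of oriented edges. -/
def ker (c : Collapse Γ Γ') : Set Γ.D := {d | c.onD d = none}

lemma mem_ker {c : Collapse Γ Γ'} {d : Γ.D} : d ∈ c.ker ↔ c.onD d = none := Iff.rfl

lemma onD_inj (c : Collapse Γ Γ') {d e : Γ.D} {x : Γ'.D} (hd : c.onD d = some x)
    (he : c.onD e = some x) : d = e := (c.bijOn_edges x).unique hd he

lemma exists_onD (c : Collapse Γ Γ') (x : Γ'.D) : ∃ d, c.onD d = some x :=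
  (c.bijOn_edges x).exists

lemma exists_of_notMem_ker {c : Collapse Γ Γ'} {d : Γ.D} (h : d ∉ c.ker) :
    ∃ x, c.onD d = some x := Option.ne_none_iff_exists'.1 h

lemma onD_rev (c : Collapse Γ Γ') {d : Γ.D} {x : Γ'.D} (h : c.onD d = some x) :
    c.onD (Γ.rev d) = some (Γ'.rev x) := by rw [c.map_rev, h]; rfl

lemma onV_tgt (c : Collapse Γ Γ') {d : Γ.D} {x : Γ'.D} (h : c.onD d = some x) :
    Γ'.tgt x = c.onV (Γ.tgt d) := c.map_src _ _ (c.onD_rev h)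

lemma onV_src_of_mem_ker (c : Collapse Γ Γ') {d : Γ.D} (h : d ∈ c.ker) :
    c.onV (Γ.src d) = c.onV (Γ.tgt d) := (c.onV_eq_iff _ _).2 (Joined.edge h)

lemma onV_eq_iff_joined (c : Collapse Γ Γ') (u v : Γ.V) :
    c.onV u = c.onV v ↔ Γ.Joined c.ker u v := c.onV_eq_iff u v

lemma isPath_filterMap (c : Collapse Γ Γ') {u v : Γ.V} {l : List Γ.D} (h : Γ.IsPath u l v) :
    Γ'.IsPath (c.onV u) (l.filterMap c.onD) (c.onV v) := by
  induction l generalizing u with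
  | nil => cases h; rfl
  | cons d l ih =>
    obtain ⟨rfl, hl⟩ := h
    cases hd : c.onD d with
    | none => rw [List.filterMap_cons_none hd, c.onV_src_of_mem_ker hd]; exact ih hl
    | some x =>
      rw [List.filterMap_cons_some hd]
      exact ⟨c.map_src _ _ hd, by rw [c.onV_tgt hd]; exact ih hl⟩

/-- A collapse takes taut edge paths to taut edge paths: a backtrack in the image would come from
a closed taut path in the forest. -/
lemma isTaut_filterMap (c : Collapse Γ Γ') {u v : Γ.V} {l : List Γ.D} (h : Γ.IsPath u l v)
    (ht : Γ.IsTaut l) : Γ'.IsTaut (l.filterMap c.onD) := by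
  induction l generalizing u with
  | nil => exact isTaut_nil
  | cons d l ih =>
    have ih' := ih h.2 ht.tail
    cases hd : c.onD d with
    | none => rwa [List.filterMap_cons_none hd]
    | some x =>
      rw [List.filterMap_cons_some hd]
      cases hm : l.filterMap c.onD with
      | nil => exact isTaut_singleton x
      | cons y t =>
        refine List.isChain_cons_cons.2 ⟨?_, hm ▸ ih'⟩
        rintro rfl
        obtain ⟨p, e, r, rfl, hp, he, -⟩ := List.filterMap_eq_cons_iff.1 hm
        obtain rfl : e = Γ.rev d := c.onD_inj he (c.onD_rev hd)
        obtain ⟨w, hpw, hw⟩ := isPath_append_iff.1 h.2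
        obtain rfl : Γ.tgt d = w := hw.1
        have hpt : Γ.IsTaut p := (List.isChain_append.1 ht.tail).1
        obtain rfl := c.isForest.2 _ p hpw hpt hp
        exact (List.isChain_cons_cons.1 ht).1 rfl

lemma map_edge (c : Collapse Γ Γ') (d : Γ.D) :
    c.map (Γ.edge d) = (c.onD d).elim 1 Γ'.edge := Γ.liftEdges_edge _ _ d

lemma map_pathClass (c : Collapse Γ Γ') (l : List Γ.D) :
    c.map (Γ.pathClass l) = Γ'.pathClass (l.filterMap c.onD) := by
  induction l with
  | nil => simp [pathClass]
  | cons d l ih =>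
    rw [pathClass_cons, map_mul, ih, map_edge]
    cases hd : c.onD d with
    | none => simp [List.filterMap_cons_none hd]
    | some x => simp [List.filterMap_cons_some hd, pathClass_cons]

lemma exists_lift (c : Collapse Γ Γ') {u v : Γ.V} {l' : List Γ'.D}
    (h : Γ'.IsPath (c.onV u) l' (c.onV v)) :
    ∃ l, Γ.IsPath u l v ∧ l.filterMap c.onD = l' := by
  induction l' generalizing u with
  | nil =>
    obtain ⟨l, hl, hk⟩ := (c.onV_eq_iff u v).1 h
    exact ⟨l, hl, List.filterMap_eq_nil_iff.2 hk⟩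
  | cons x l' ih =>
    obtain ⟨hx, hl'⟩ := h
    obtain ⟨d, hd⟩ := c.exists_onD x
    rw [c.map_src _ _ hd] at hx
    obtain ⟨p, hp, hk⟩ := (c.onV_eq_iff _ _).1 hx.symm
    rw [c.onV_tgt hd] at hl'
    obtain ⟨l, hl, hm⟩ := ih hl'
    refine ⟨p ++ d :: l, hp.append ⟨rfl, hl⟩, ?_⟩
    rw [List.filterMap_append, List.filterMap_cons_some hd, hm,
      List.filterMap_eq_nil_iff.2 hk, List.nil_append]

/-- The composition of two collapses. -/
def comp (c' : Collapse Γ' Γ'') (c : Collapse Γ Γ') : Collapse Γ Γ'' where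
  onV := c'.onV ∘ c.onV
  onD d := (c.onD d).bind c'.onD
  map_rev d := by
    rw [c.map_rev]
    cases c.onD d with
    | none => rfl
    | some x => exact c'.map_rev x
  map_src d y h := by
    obtain ⟨x, hx, hy⟩ := Option.bind_eq_some_iff.1 h
    rw [c'.map_src _ _ hy, c.map_src _ _ hx]; rfl
  map_base := by simp [c.map_base, c'.map_base]
  bijOn_edges y := by
    obtain ⟨x, hx⟩ := c'.exists_onD y
    obtain ⟨d, hd⟩ := c.exists_onD x
    refine ⟨d, by simp [hd, hx], fun e he => ?_⟩
    obtain ⟨x', hx', hy⟩ := Option.bind_eq_some_iff.1 he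
    obtain rfl := c'.onD_inj hx hy
    exact c.onD_inj hx' hd
  surjective_onV := c'.surjective_onV.comp c.surjective_onV
  onV_eq_iff u v := by
    rw [Function.comp_apply, Function.comp_apply, c'.onV_eq_iff]
    constructor
    · rintro ⟨l', hl', hk⟩
      obtain ⟨l, hl, rfl⟩ := c.exists_lift hl'
      refine ⟨l, hl, fun d hd => ?_⟩
      cases hx : c.onD d with
      | none => simp [hx]
      | some x =>
        have := hk x (List.mem_filterMap.2 ⟨d, hd, hx⟩)
        simpa [hx] using this
    · rintro ⟨l, hl, hk⟩
      refine ⟨_, c.isPath_filterMap hl, fun x hx => ?_⟩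
      obtain ⟨d, hd, hx⟩ := List.mem_filterMap.1 hx
      simpa [hx] using hk d hd
  isForest := by
    constructor
    · intro d hd
      rw [Set.mem_ofPred_eq] at *
      rw [c.map_rev]
      cases hx : c.onD d with
      | none => rfl
      | some x =>
        rw [hx] at hd
        exact c'.isForest.1 x hd
    · intro u l hl ht hk
      have h0 := c'.isForest.2 _ _ (c.isPath_filterMap hl) (c.isTaut_filterMap hl ht) (by
        intro x hx
        obtain ⟨d, hd, hx⟩ := List.mem_filterMap.1 hx
        simpa [hx] using hk d hd)
      exact c.isForest.2 u l hl ht (List.filterMap_eq_nil_iff.1 h0)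

lemma comp_map (c' : Collapse Γ' Γ'') (c : Collapse Γ Γ') (w : Γ.PathGroup) :
    (c'.comp c).map w = c'.map (c.map w) := by
  have : (c'.comp c).map = c'.map.comp c.map := PresentedGroup.ext fun d => by
    change (c'.comp c).map (Γ.edge d) = c'.map (c.map (Γ.edge d))
    rw [map_edge, map_edge]
    change ((c.onD d).bind c'.onD).elim 1 Γ''.edge = _
    cases c.onD d with
    | none => simp
    | some x => exact (c'.map_edge x).symm
  rw [this]; rfl

end Collapse

namespace GraphIso

variable {Γ Γ' Γ'' : PGraph}

lemma map_edge (h : GraphIso Γ Γ') (d : Γ.D) : h.map (Γ.edge d) = Γ'.edge (h.onD d) :=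
  Γ.liftEdges_edge _ _ d

lemma map_tgt (h : GraphIso Γ Γ') (d : Γ.D) : Γ'.tgt (h.onD d) = h.onV (Γ.tgt d) := by
  rw [tgt, h.map_rev, h.map_src]; rfl

lemma isPath_map (h : GraphIso Γ Γ') {u v : Γ.V} {l : List Γ.D} (hl : Γ.IsPath u l v) :
    Γ'.IsPath (h.onV u) (l.map h.onD) (h.onV v) := by
  induction l generalizing u with
  | nil => cases hl; rfl
  | cons d l ih =>
    obtain ⟨rfl, hl⟩ := hl
    exact ⟨h.map_src d, by rw [map_tgt]; exact ih hl⟩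

lemma isTaut_map (h : GraphIso Γ Γ') {l : List Γ.D} (hl : Γ.IsTaut l) :
    Γ'.IsTaut (l.map h.onD) := by
  unfold IsTaut at *
  rw [List.isChain_map]
  refine hl.imp fun a b hab h' => hab (h.onD.injective ?_)
  rw [h', h.map_rev]

/-- An isomorphism is a collapse with empty forest. -/
def toCollapse (h : GraphIso Γ Γ') : Collapse Γ Γ' where
  onV := h.onV
  onD d := some (h.onD d)
  map_rev d := by rw [Option.map_some, h.map_rev]
  map_src d x hx := by cases hx; exact h.map_src d
  map_base := h.map_base
  bijOn_edges x := ⟨h.onD.symm x, by simp, fun d hd => by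
    rw [Equiv.eq_symm_apply]; exact Option.some.inj hd⟩
  surjective_onV := h.onV.surjective
  onV_eq_iff u v := by simpa using joined_empty_iff.symm
  isForest := ⟨by simp, fun u l _ _ hk => by
    cases l with
    | nil => rfl
    | cons d l => exact absurd (hk d (by simp)) (by simp)⟩

lemma toCollapse_map (h : GraphIso Γ Γ') : h.toCollapse.map = h.map :=
  PresentedGroup.ext fun _ => rfl

end GraphIso

namespace Collapse

variable {Γ Γ' : PGraph}

lemma filterMap_eq_of_map_eq {c c' : Collapse Γ Γ'} (h : ∀ w ∈ Γ.pi1, c.map w = c'.map w)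
    {l : List Γ.D} (hl : Γ.IsPath Γ.base l Γ.base) (ht : Γ.IsTaut l) :
    l.filterMap c.onD = l.filterMap c'.onD := by
  refine (c.isTaut_filterMap hl ht).eq_of_pathClass_eq (c'.isTaut_filterMap hl ht) ?_
  rw [← map_pathClass, ← map_pathClass]
  exact h _ ⟨l, hl, rfl⟩

/-- If `c` collapses the last edge of a taut path from the base and `c'` does not, then the two
collapses cannot agree on the fundamental group.  Otherwise every taut continuation of the path
has to leave the forest of `c` through one and the same edge, which is impossible as there are two
ways to continue. -/
lemma onD_ne_none_of_map_eq (hΓ : Γ.IsAdmissible) {c c' : Collapse Γ Γ'}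
    (h : ∀ w ∈ Γ.pi1, c.map w = c'.map w) {l : List Γ.D} {d : Γ.D}
    (hl : Γ.IsPath Γ.base l (Γ.src d)) (ht : Γ.IsTaut (l ++ [d]))
    (hf : l.filterMap c.onD = l.filterMap c'.onD) {b : Γ'.D} (hb : c'.onD d = some b) :
    c.onD d ≠ none := by
  intro hn
  have hld : Γ.IsPath Γ.base (l ++ [d]) (Γ.tgt d) := hl.append (IsPath.singleton d)
  by_cases hbase : Γ.tgt d = Γ.base
  · have := filterMap_eq_of_map_eq h (hbase ▸ hld) ht
    simp [List.filterMap_append, hf, hn, hb] at this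
  have key : ∀ e, Γ.src e = Γ.tgt d → e ≠ Γ.rev d → ∃ p x, Γ.IsPath (Γ.tgt d) p (Γ.src x) ∧
      Γ.IsTaut p ∧ (∀ y ∈ p, c.onD y = none) ∧ c.onD x = some b ∧ (p = [] → x = e) ∧
      ∀ y ∈ p.head?, y = e := by
    intro e he hne
    obtain ⟨q, hq, htq⟩ := hΓ.exists_return e
    have htd : Γ.IsTaut (d :: e :: q) := List.isChain_cons_cons.2 ⟨hne, htq⟩
    have hfull := filterMap_eq_of_map_eq h (hld.append (l' := e :: q) ⟨he, hq⟩)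
      (ht.append_cons htd)
    rw [List.filterMap_append, List.filterMap_append, List.filterMap_append,
      List.filterMap_append, hf, List.append_assoc, List.append_assoc,
      List.append_cancel_left_eq, List.filterMap_cons_none hn, List.filterMap_cons_some hb] at hfull
    simp only [List.filterMap_nil, List.nil_append, List.cons_append] at hfull
    obtain ⟨p, x, r, hpr, hp, hx, -⟩ := List.filterMap_eq_cons_iff.1 hfull
    have hpath : Γ.IsPath (Γ.tgt d) (e :: q) Γ.base := ⟨he, hq⟩
    rw [hpr] at htq hpath
    obtain ⟨w, hpw, hw⟩ := isPath_append_iff.1 hpath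
    obtain rfl := hw.1
    refine ⟨p, x, hpw, (List.isChain_append.1 htq).1, hp, hx, ?_, ?_⟩
    · rintro rfl
      exact (List.cons.inj hpr).1.symm
    · intro y hy
      cases p with
      | nil => simp at hy
      | cons z p =>
        simp only [List.head?_cons, Option.mem_def, Option.some.injEq] at hy
        rw [← hy]
        exact (List.cons.inj hpr).1.symm
  classical
  have := Γ.finD
  have hval := hΓ.valence_ne_base _ hbase
  obtain ⟨e, e', he, he', hee, hed, hed'⟩ : ∃ e e', Γ.src e = Γ.tgt d ∧ Γ.src e' = Γ.tgt d ∧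
      e ≠ e' ∧ e ≠ Γ.rev d ∧ e' ≠ Γ.rev d := by
    have := Fintype.ofFinite {x // Γ.src x = Γ.tgt d}
    rw [valence, Nat.card_eq_fintype_card] at hval
    obtain ⟨a, ha, b', hb', hab⟩ := Finset.one_lt_card.1
      (show 1 < ((Finset.univ : Finset {x // Γ.src x = Γ.tgt d}).erase ⟨Γ.rev d, rfl⟩).card by
        rw [Finset.card_erase_of_mem (Finset.mem_univ _), Finset.card_univ]; omega)
    refine ⟨a, b', a.2, b'.2, fun h => hab (Subtype.ext h), fun h => ?_, fun h => ?_⟩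
    · exact (Finset.mem_erase.1 ha).1 (Subtype.ext h)
    · exact (Finset.mem_erase.1 hb').1 (Subtype.ext h)
  obtain ⟨p, x, hp, htp, hkp, hx, hp0, hph⟩ := key e he hed
  obtain ⟨p', x', hp', htp', hkp', hx', hp0', hph'⟩ := key e' he' hed'
  obtain rfl := c.onD_inj hx hx'
  have hclosed := hp'.reverse.append hp
  have htaut : Γ.IsTaut ((p'.map Γ.rev).reverse ++ p) := by
    refine List.isChain_append.2 ⟨htp'.reverse, htp, fun y hy z hz => ?_⟩
    obtain rfl := hph z hz
    rw [List.getLast?_reverse, List.head?_map, Option.mem_map] at hy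
    obtain ⟨t, ht', rfl⟩ := hy
    obtain rfl := hph' t ht'
    rwa [Γ.rev_rev]
  have hnil := c.isForest.2 _ _ hclosed htaut (by
    intro y hy
    rcases List.mem_append.1 hy with hy | hy
    · obtain ⟨t, ht', rfl⟩ := List.mem_map.1 (List.mem_reverse.1 hy)
      exact c.isForest.1 t (hkp' t ht')
    · exact hkp y hy)
  simp only [List.append_eq_nil_iff, List.reverse_eq_nil_iff, List.map_eq_nil_iff] at hnil
  exact hee ((hp0 hnil.2).symm.trans (hp0' hnil.1))

/-- On the edges, a collapse of an admissible graph is determined by what it does on the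
fundamental group. -/
theorem onD_eq_of_map_eq (hΓ : Γ.IsAdmissible) {c c' : Collapse Γ Γ'}
    (h : ∀ w ∈ Γ.pi1, c.map w = c'.map w) : c.onD = c'.onD := by
  have key : ∀ (l : List Γ.D) (d : Γ.D), Γ.IsPath Γ.base l (Γ.src d) → Γ.IsTaut (l ++ [d]) →
      l.filterMap c.onD = l.filterMap c'.onD → c.onD d = c'.onD d := by
    intro l d hl ht hf
    cases ha : c.onD d with
    | none =>
      cases hb : c'.onD d with
      | none => rfl
      | some b => exact absurd ha (onD_ne_none_of_map_eq hΓ h hl ht hf hb)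
    | some a =>
      cases hb : c'.onD d with
      | none =>
        exact absurd hb (onD_ne_none_of_map_eq hΓ (fun w hw => (h w hw).symm) hl ht hf.symm ha)
      | some b =>
        obtain ⟨q, hq, htq⟩ := hΓ.exists_return d
        have hfull := filterMap_eq_of_map_eq h ((hl.append (IsPath.singleton d)).append hq)
          (ht.append_cons htq)
        simp only [List.filterMap_append, hf, List.append_assoc, List.append_cancel_left_eq,
          List.filterMap_cons_some ha, List.filterMap_cons_some hb, List.filterMap_nil,
          List.cons_append] at hfull
        exact congrArg some (List.cons.inj hfull).1
  have prefix_eq : ∀ (l : List Γ.D) (v : Γ.V), Γ.IsPath Γ.base l v → Γ.IsTaut l →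
      l.filterMap c.onD = l.filterMap c'.onD := by
    intro l
    induction l using List.reverseRecOn with
    | nil => intros; rfl
    | append_singleton l d ih =>
      intro v hl ht
      obtain ⟨w, hw, hd⟩ := isPath_append_iff.1 hl
      obtain rfl := hd.1
      have hf := ih _ hw (List.isChain_append.1 ht).1
      have := key l d hw ht hf
      rw [List.filterMap_append, List.filterMap_append, hf]
      simp [List.filterMap_cons, this]
  funext d
  obtain ⟨q, hq, ht⟩ := hΓ.exists_approach d
  exact key q d hq ht (prefix_eq q _ hq (List.isChain_append.1 ht).1)

/-- On the vertices, a collapse of a connected graph is determined by what it does on the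
edges. -/
lemma onV_eq_of_onD_eq (hΓ : Γ.IsAdmissible) {c c' : Collapse Γ Γ'} (h : c.onD = c'.onD) :
    c.onV = c'.onV := by
  funext v
  obtain ⟨l, hl, -⟩ := hΓ.connected Γ.base v
  have h1 := c.isPath_filterMap hl
  have h2 := c'.isPath_filterMap hl
  rw [c.map_base] at h1
  rw [c'.map_base, ← h] at h2
  exact h1.end_unique h2

lemma onV_eq_of_map_eq (hΓ : Γ.IsAdmissible) {c c' : Collapse Γ Γ'}
    (h : ∀ w ∈ Γ.pi1, c.map w = c'.map w) : c.onV = c'.onV :=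
  onV_eq_of_onD_eq hΓ (onD_eq_of_map_eq hΓ h)

end Collapse

end PalAut
namespace PalAut

open PGraph

/-! ### Cochains of graphs -/

namespace PGraph

variable {Γ : PGraph}

/-- A `1`-cochain: a function on the oriented edges that changes sign under reversal. -/
def IsCochain {A : Type*} [AddCommGroup A] (f : Γ.D → A) : Prop := ∀ d, f (Γ.rev d) = -f d

/-- The homomorphism out of the path group given by a cochain. -/
def evalHom {A : Type*} [AddCommGroup A] (f : Γ.D → A) (hf : IsCochain f) :
    Γ.PathGroup →* Multiplicative A :=
  Γ.liftEdges (fun d => Multiplicative.ofAdd (f d)) fun d => by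
    rw [hf, ← ofAdd_add, add_neg_cancel, ofAdd_zero]

lemma evalHom_pathClass {A : Type*} [AddCommGroup A] (f : Γ.D → A) (hf : IsCochain f)
    (l : List Γ.D) : evalHom f hf (Γ.pathClass l) = Multiplicative.ofAdd (l.map f).sum := by
  induction l with
  | nil => simp [pathClass]
  | cons d l ih =>
    rw [pathClass_cons, map_mul, ih, List.map_cons, List.sum_cons, ofAdd_add]
    congr 1
    exact Γ.liftEdges_edge _ _ d

/-- A cochain that vanishes on the closed paths at the base is a coboundary. -/
lemma exists_potential {A : Type*} [AddCommGroup A] (hΓ : Γ.IsAdmissible) {f : Γ.D → A}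
    (hf : IsCochain f) (h : ∀ l, Γ.IsPath Γ.base l Γ.base → (l.map f).sum = 0) :
    ∃ g : Γ.V → A, g Γ.base = 0 ∧ ∀ d, f d = g (Γ.tgt d) - g (Γ.src d) := by
  choose p hp using fun v => hΓ.connected Γ.base v
  have hrev : ∀ l : List Γ.D, ((l.map Γ.rev).reverse.map f).sum = -(l.map f).sum := by
    intro l
    induction l with
    | nil => simp
    | cons d l ih => simp_all [hf d, add_comm]
  refine ⟨fun v => ((p v).map f).sum, h _ (hp _).1, fun d => ?_⟩
  have := h _ (((hp (Γ.src d)).1.append (IsPath.singleton d)).append (hp (Γ.tgt d)).1.reverse)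
  rw [List.map_append, List.sum_append, hrev, List.map_append, List.sum_append] at this
  simp only [List.map_cons, List.map_nil, List.sum_cons, List.sum_nil, add_zero] at this
  rw [eq_sub_iff_add_eq, add_comm]
  exact add_neg_eq_zero.1 this

open Classical in
/-- The cochain dual to the oriented edge `d`. -/
noncomputable def dualCochain (d : Γ.D) (e : Γ.D) : ℤ :=
  (if e = d then 1 else 0) - if e = Γ.rev d then 1 else 0

lemma isCochain_dualCochain (d : Γ.D) : IsCochain (dualCochain d) := by
  classical
  intro e
  have h1 : Γ.rev e = d ↔ e = Γ.rev d :=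
    ⟨fun h => by rw [← h, Γ.rev_rev], fun h => by rw [h, Γ.rev_rev]⟩
  have h2 : Γ.rev e = Γ.rev d ↔ e = d := rev_injective.eq_iff
  rw [dualCochain, dualCochain, neg_sub]
  exact congrArg₂ (· - ·) (if_congr h1 rfl rfl) (if_congr h2 rfl rfl)

lemma dualCochain_self (d : Γ.D) : dualCochain d d = 1 := by
  simp [dualCochain, (Γ.rev_ne d).symm]

lemma dualCochain_of_ne {d e : Γ.D} (h : e ≠ d) (h' : e ≠ Γ.rev d) : dualCochain d e = 0 := by
  simp [dualCochain, h, h']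

lemma dualCochain_iso (h : GraphIso Γ Γ) (d e : Γ.D) :
    dualCochain (h.onD d) (h.onD e) = dualCochain d e := by
  classical
  have h1 : h.onD e = h.onD d ↔ e = d := h.onD.injective.eq_iff
  have h2 : h.onD e = Γ.rev (h.onD d) ↔ e = Γ.rev d := by
    rw [h.map_rev, h.onD.injective.eq_iff]
  exact congrArg₂ (· - ·) (if_congr h1 rfl rfl) (if_congr h2 rfl rfl)

end PGraph

variable {n : ℕ}

/-- As `σ_n` acts by `-1` on the abelianization, an invariant cochain vanishes on the fundamental
group: in other words, the quotient of the graph by the involution is a tree. -/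
lemma Realizes.sum_eq_zero {M : MarkedGraph n} {h : GraphIso M.graph M.graph} (hr : Realizes M h)
    {f : M.graph.D → ℤ} (hf : IsCochain f) (hinv : ∀ d, f (h.onD d) = f d) {l : List M.graph.D}
    (hl : M.graph.IsPath M.graph.base l M.graph.base) : (l.map f).sum = 0 := by
  have hcomp : ∀ w, evalHom f hf (h.map w) = evalHom f hf w := by
    have : (evalHom f hf).comp h.map = evalHom f hf := PresentedGroup.ext fun d => by
      change evalHom f hf (h.map (M.graph.edge d)) = evalHom f hf (M.graph.edge d)
      rw [h.map_edge]
      simp [evalHom, hinv]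
    exact DFunLike.congr_fun this
  set ψ : FreeGroup (Fin n) →* Multiplicative ℤ :=
    (evalHom f hf).comp (M.graph.pi1.subtype.comp M.mark.toMonoidHom) with hψ
  have hψ1 : ψ = 1 := by
    ext i
    have h1 : ψ (FreeGroup.of i) = evalHom f hf (M.mark (FreeGroup.of i)) := rfl
    have h2 := hr (FreeGroup.of i)
    rw [sigma_of] at h2
    have h3 : ψ (FreeGroup.of i)⁻¹ = ψ (FreeGroup.of i) := by
      rw [h1, ← hcomp, h2]; rfl
    rw [map_inv] at h3
    have h4 : -(Multiplicative.toAdd (ψ (FreeGroup.of i))) =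
      Multiplicative.toAdd (ψ (FreeGroup.of i)) := congrArg Multiplicative.toAdd h3
    exact Multiplicative.toAdd.injective (show Multiplicative.toAdd (ψ (FreeGroup.of i)) = 0 by
      omega)
  have h5 : ψ (M.mark.symm ⟨_, l, hl, rfl⟩) = 1 := by rw [hψ1]; rfl
  have h6 : ψ (M.mark.symm ⟨_, l, hl, rfl⟩) = evalHom f hf (M.graph.pathClass l) := by
    simp [hψ]
  rw [h6, evalHom_pathClass] at h5
  exact ofAdd_eq_one.1 h5

/-- The involution fixes no oriented edge, since edges are not separating. -/
lemma Realizes.onD_ne {M : MarkedGraph n} {h : GraphIso M.graph M.graph} (hr : Realizes M h)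
    (d : M.graph.D) : h.onD d ≠ d := by
  intro hd
  obtain ⟨g, -, hg⟩ := exists_potential M.admissible (isCochain_dualCochain d)
    (fun l hl => hr.sum_eq_zero (isCochain_dualCochain d)
      (fun e => by conv_lhs => rw [← hd]
                   exact dualCochain_iso h d e) hl)
  have h1 : g (M.graph.tgt d) = g (M.graph.src d) := by
    refine Joined.mem_of_closed (S := {u | g u = g (M.graph.src d)}) (fun e he hs => ?_)
      (M.admissible.noSeparatingEdge d) rfl
    have := hg e
    rw [dualCochain_of_ne he.1 he.2] at this
    exact (sub_eq_zero.1 this.symm).trans hs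
  have := hg d
  rw [dualCochain_self, h1] at this
  omega

lemma Realizes.onD_onD {M : MarkedGraph n} {h : GraphIso M.graph M.graph} (hr : Realizes M h)
    (d : M.graph.D) : h.onD (h.onD d) = d := by
  have := Collapse.onD_eq_of_map_eq M.admissible (c := (h.trans h).toCollapse)
    (c' := (GraphIso.refl _).toCollapse) (by
      intro w hw
      rw [GraphIso.toCollapse_map, GraphIso.toCollapse_map, GraphIso.map_refl, GraphIso.map_trans]
      obtain ⟨x, hx⟩ := M.mark.surjective ⟨w, hw⟩
      have hx' : w = M.mark x := by rw [hx]
      rw [hx', hr, hr]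
      congr 2
      have : (sigma n).toMonoidHom.comp (sigma n).toMonoidHom = MonoidHom.id _ := by
        ext i; simp
      exact DFunLike.congr_fun this x)
  exact Option.some.inj (congrFun this d)

lemma GraphIso.onV_involutive {Γ : PGraph} (hΓ : Γ.IsAdmissible) {h : GraphIso Γ Γ}
    (hh : ∀ d, h.onD (h.onD d) = d) (v : Γ.V) : h.onV (h.onV v) = v := by
  have := Collapse.onV_eq_of_onD_eq hΓ (c := (h.trans h).toCollapse)
    (c' := (GraphIso.refl _).toCollapse) (funext fun d => congrArg some (hh d))
  exact congrFun this v

lemma Realizes.onV_onV {M : MarkedGraph n} {h : GraphIso M.graph M.graph} (hr : Realizes M h)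
    (v : M.graph.V) : h.onV (h.onV v) = v := GraphIso.onV_involutive M.admissible hr.onD_onD v

/-- For an edge `d` that starts at a fixed vertex `v`, there is an automorphism which is the
involution on the branch at `v` that contains `d`, and the identity elsewhere.  The branch is the
set where the potential of the invariant cochain `d + h d` takes its larger value. -/
lemma GraphIso.exists_branchSwap {Γ : PGraph} (hΓ : Γ.IsAdmissible) {h : GraphIso Γ Γ}
    (hhD : ∀ e, h.onD (h.onD e) = e) (hfree : ∀ e, h.onD e ≠ e)
    (hsum : ∀ f : Γ.D → ℤ, IsCochain f → (∀ e, f (h.onD e) = f e) →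
      ∀ l, Γ.IsPath Γ.base l Γ.base → (l.map f).sum = 0)
    {d : Γ.D} (hv : h.onV (Γ.src d) = Γ.src d) :
    ∃ t : GraphIso Γ Γ, (∀ e, t.onD (h.onD e) = h.onD (t.onD e)) ∧
      (∀ e, t.onD e = e ∨ t.onD e = h.onD e) ∧ t.onD d = h.onD d ∧
      ∀ e, Γ.src e = Γ.src d → e ≠ d → e ≠ h.onD d → t.onD e = e := by
  classical
  have hhV := GraphIso.onV_involutive hΓ hhD
  set f : Γ.D → ℤ := fun e => dualCochain d e + dualCochain (h.onD d) e with hfdef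
  have hf : IsCochain f := fun e => by
    simp only [hfdef, isCochain_dualCochain d e, isCochain_dualCochain (h.onD d) e]; ring
  have hinv : ∀ e, f (h.onD e) = f e := fun e => by
    have h1 := dualCochain_iso h (h.onD d) e
    rw [hhD] at h1
    simp only [hfdef]
    rw [dualCochain_iso, h1, add_comm]
  obtain ⟨g, hg0, hg⟩ := exists_potential hΓ hf (hsum f hf hinv)
  have hgh : ∀ u, g (h.onV u) = g u := by
    intro u
    have : g (h.onV u) - g u = 0 := by
      refine Joined.mem_of_closed (S := {u | g (h.onV u) - g u = 0}) (fun e _ hs => ?_)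
        (hΓ.connected Γ.base u) ?_
      · have h1 := hg (h.onD e)
        rw [hinv, hg e, h.map_src, h.map_tgt] at h1
        have hs' : g (h.onV (Γ.src e)) - g (Γ.src e) = 0 := hs
        change g (h.onV (Γ.tgt e)) - g (Γ.tgt e) = 0
        omega
      · change g (h.onV Γ.base) - g Γ.base = 0
        rw [h.map_base, sub_self]
    omega
  set v := Γ.src d with hvdef
  set O : Set Γ.D := {e | e = d ∨ e = h.onD d ∨ e = Γ.rev d ∨ e = Γ.rev (h.onD d)} with hO
  have hOh : ∀ e, e ∈ O → h.onD e ∈ O := by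
    rintro e (rfl | rfl | rfl | rfl)
    · exact Or.inr (Or.inl rfl)
    · exact Or.inl (hhD _)
    · exact Or.inr (Or.inr (Or.inr (h.map_rev _).symm))
    · exact Or.inr (Or.inr (Or.inl (by rw [← h.map_rev, hhD])))
  have hOr : ∀ e, e ∈ O → Γ.rev e ∈ O := by
    rintro e (rfl | rfl | rfl | rfl)
    · exact Or.inr (Or.inr (Or.inl rfl))
    · exact Or.inr (Or.inr (Or.inr rfl))
    · exact Or.inl (Γ.rev_rev _)
    · exact Or.inr (Or.inl (Γ.rev_rev _))
  have hfO : ∀ e, e ∉ O → g (Γ.tgt e) = g (Γ.src e) := by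
    intro e he
    simp only [hO, Set.mem_ofPred_eq, not_or] at he
    have := hg e
    simp only [hfdef] at this
    rw [dualCochain_of_ne he.1 he.2.2.1, dualCochain_of_ne he.2.1 he.2.2.2] at this
    omega
  have hloop : h.onD d = Γ.rev d ∨ g (Γ.tgt d) = g v + 1 := by
    by_cases hc : h.onD d = Γ.rev d
    · exact Or.inl hc
    · right
      have : f d = g (Γ.tgt d) - g v := hg d
      simp only [hfdef] at this
      rw [dualCochain_self, dualCochain_of_ne (hfree d).symm] at this
      · omega
      · exact fun hd => hc (rev_injective (by rw [← hd, Γ.rev_rev]))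
  set B : Set Γ.D := {e | e ∈ O ∨ g (Γ.src e) = g v + 1} with hB
  have hBh : ∀ e, h.onD e ∈ B ↔ e ∈ B := by
    have : ∀ e, e ∈ B → h.onD e ∈ B := by
      rintro e (he | he)
      · exact Or.inl (hOh e he)
      · right; rw [h.map_src, hgh, he]
    exact fun e => ⟨fun he => hhD e ▸ this _ he, this e⟩
  have hBr : ∀ e, Γ.rev e ∈ B ↔ e ∈ B := by
    have : ∀ e, e ∈ B → Γ.rev e ∈ B := by
      intro e he
      by_cases heO : e ∈ O
      · exact Or.inl (hOr e heO)
      · right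
        change g (Γ.tgt e) = _
        rw [hfO e heO]
        exact he.resolve_left heO
    exact fun e => ⟨fun he => Γ.rev_rev e ▸ this _ he, this e⟩
  set tD : Γ.D → Γ.D := fun e => if e ∈ B then h.onD e else e with htD
  set tV : Γ.V → Γ.V := fun u => if g u = g v + 1 then h.onV u else u with htV
  have htDi : Function.Involutive tD := fun e => by
    simp only [htD]
    by_cases he : e ∈ B
    · rw [if_pos he, if_pos ((hBh e).2 he), hhD]
    · rw [if_neg he, if_neg he]
  have htVi : Function.Involutive tV := fun u => by
    simp only [htV]
    by_cases he : g u = g v + 1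
    · rw [if_pos he, if_pos (by rw [hgh, he]), hhV]
    · rw [if_neg he, if_neg he]
  have hsrcO : ∀ e ∈ O, g (Γ.src e) ≠ g v + 1 → h.onV (Γ.src e) = Γ.src e := by
    have hr1 : g (Γ.tgt d) ≠ g v + 1 → Γ.tgt d = v := fun hne => by
      have hc := hloop.resolve_right hne
      change Γ.src (Γ.rev d) = v
      rw [← hc, h.map_src, hv]
    rintro e (rfl | rfl | rfl | rfl) hne
    · exact hv
    · rw [h.map_src, hv, hv]
    · have := hr1 hne
      change h.onV (Γ.tgt d) = Γ.tgt d
      rw [this, hv]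
    · change g (Γ.tgt (h.onD d)) ≠ _ at hne
      rw [h.map_tgt, hgh] at hne
      change h.onV (Γ.tgt (h.onD d)) = Γ.tgt (h.onD d)
      rw [h.map_tgt, hr1 hne, hv, hv]
  refine ⟨⟨htVi.toPerm, htDi.toPerm, fun e => ?_, fun e => ?_, ?_⟩, fun e => ?_, fun e => ?_, ?_,
    fun e he hne hne' => ?_⟩
  · change Γ.src (tD e) = tV (Γ.src e)
    simp only [htD, htV]
    by_cases he : e ∈ B
    · rw [if_pos he, h.map_src]
      by_cases hs : g (Γ.src e) = g v + 1
      · rw [if_pos hs]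
      · rw [if_neg hs, hsrcO e (he.resolve_right hs) hs]
    · rw [if_neg he, if_neg fun hs => he (Or.inr hs)]
  · change Γ.rev (tD e) = tD (Γ.rev e)
    simp only [htD, hBr]
    split_ifs
    · exact h.map_rev e
    · rfl
  · change tV Γ.base = Γ.base
    simp only [htV, h.map_base, ite_self]
  · change tD (h.onD e) = h.onD (tD e)
    simp only [htD, hBh]
    split_ifs <;> rfl
  · change tD e = e ∨ tD e = h.onD e
    simp only [htD]
    split_ifs <;> simp
  · exact if_pos (Or.inl (Or.inl rfl))
  · refine if_neg ?_
    rintro ((hc | hc | hc | hc) | hc)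
    · exact hne hc
    · exact hne' hc
    · rcases hloop with hl | hl
      · exact hne' (hc.trans hl.symm)
      · rw [hc] at he
        change Γ.tgt d = v at he
        rw [he] at hl; omega
    · rcases hloop with hl | hl
      · exact hne (by rw [hc, hl, Γ.rev_rev])
      · rw [hc] at he
        change Γ.tgt (h.onD d) = v at he
        rw [h.map_tgt] at he
        rw [← hgh, he] at hl; omega
    · rw [he] at hc; omega

lemma Realizes.exists_branchSwap {M : MarkedGraph n} {h : GraphIso M.graph M.graph}
    (hr : Realizes M h) {d : M.graph.D} (hv : h.onV (M.graph.src d) = M.graph.src d) :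
    ∃ t : GraphIso M.graph M.graph, (∀ e, t.onD (h.onD e) = h.onD (t.onD e)) ∧
      (∀ e, t.onD e = e ∨ t.onD e = h.onD e) ∧ t.onD d = h.onD d ∧
      ∀ e, M.graph.src e = M.graph.src d → e ≠ d → e ≠ h.onD d → t.onD e = e :=
  GraphIso.exists_branchSwap M.admissible hr.onD_onD hr.onD_ne
    (fun _ hf hinv _ hl => hr.sum_eq_zero hf hinv hl) hv

/-! ### The Euler characteristic -/

lemma PGraph.exists_orientation (Γ : PGraph) :
    ∃ P : Set Γ.D, ∀ d, Γ.rev d ∈ P ↔ d ∉ P := by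
  have := Γ.finD
  obtain ⟨m, ⟨e⟩⟩ := Finite.exists_equiv_fin Γ.D
  refine ⟨{d | e d < e (Γ.rev d)}, fun d => ?_⟩
  have hne : e d ≠ e (Γ.rev d) := fun h => Γ.rev_ne d (e.injective h).symm
  simp only [Set.mem_ofPred_eq, Γ.rev_rev, not_lt]
  exact ⟨le_of_lt, fun h => lt_of_le_of_ne h hne.symm⟩

/-- The number of edges is at most `n - 1` plus the number of vertices: the cochains that vanish
on the images of the `n` generators are coboundaries. -/
lemma PGraph.IsAdmissible.card_edges_le {Γ : PGraph} (hΓ : Γ.IsAdmissible)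
    (m : FreeGroup (Fin n) ≃* Γ.pi1) : Nat.card Γ.D + 2 ≤ 2 * Nat.card Γ.V + 2 * n := by
  classical
  have := Γ.finD
  have := Γ.finV
  have := Fintype.ofFinite Γ.D
  have := Fintype.ofFinite Γ.V
  obtain ⟨P, hP⟩ := Γ.exists_orientation
  have hcard : Nat.card Γ.D = 2 * Nat.card P := by
    have e : ((Pᶜ : Set Γ.D) : Type) ≃ (P : Type) :=
      { toFun := fun d => ⟨Γ.rev d.1, (hP _).2 d.2⟩
        invFun := fun d => ⟨Γ.rev d.1, fun h => (hP _).1 h d.2⟩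
        left_inv := fun d => Subtype.ext (Γ.rev_rev _)
        right_inv := fun d => Subtype.ext (Γ.rev_rev _) }
    have := Nat.card_congr (Equiv.Set.sumCompl P)
    rw [Nat.card_sum, Nat.card_congr e] at this
    omega
  choose l hl hlm using fun i => (m (FreeGroup.of i)).2
  let ext' : (P → ℚ) →ₗ[ℚ] (Γ.D → ℚ) :=
    { toFun := fun f d => if h : d ∈ P then f ⟨d, h⟩ else -f ⟨Γ.rev d, (hP d).2 h⟩
      map_add' := fun f f' => by
        ext d; by_cases h : d ∈ P <;> simp [h, add_comm]
      map_smul' := fun a f => by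
        ext d; by_cases h : d ∈ P <;> simp [h] }
  have hext : ∀ f, IsCochain (ext' f) := fun f d => by
    by_cases h : d ∈ P
    · have h' : Γ.rev d ∉ P := fun h' => (hP d).1 h' h
      simp [ext', h, h', Γ.rev_rev]
    · have h' := (hP d).2 h
      simp [ext', h, h']
  let Φ : (P → ℚ) →ₗ[ℚ] (Fin n → ℚ) :=
    { toFun := fun f i => ((l i).map (ext' f)).sum
      map_add' := fun f f' => by
        ext i
        simp only [map_add, Pi.add_apply]
        rw [← List.sum_map_add]; rfl
      map_smul' := fun a f => by
        ext i
        simp only [map_smul, Pi.smul_apply, smul_eq_mul, RingHom.id_apply]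
        rw [← List.sum_map_mul_left]; rfl }
  let bd (g : {v // v ≠ Γ.base} → ℚ) (v : Γ.V) : ℚ := if h : v ≠ Γ.base then g ⟨v, h⟩ else 0
  let Ψ : ({v // v ≠ Γ.base} → ℚ) →ₗ[ℚ] (P → ℚ) :=
    { toFun := fun g d => bd g (Γ.tgt d) - bd g (Γ.src d)
      map_add' := fun g g' => by
        ext d
        simp only [bd, Pi.add_apply]
        split_ifs <;> ring
      map_smul' := fun a g => by
        ext d
        simp only [bd, Pi.smul_apply, smul_eq_mul, RingHom.id_apply]
        split_ifs <;> ring }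
  have hker : LinearMap.ker Φ ≤ LinearMap.range Ψ := by
    intro f hf
    have hψ : (evalHom (ext' f) (hext f)).comp
        (Γ.pi1.subtype.comp m.toMonoidHom) = 1 := by
      ext i
      change evalHom (ext' f) (hext f) (m (FreeGroup.of i)) = 1
      rw [← hlm i, evalHom_pathClass]
      exact congrArg Multiplicative.ofAdd (congrFun (LinearMap.mem_ker.1 hf) i)
    obtain ⟨g, hg0, hg⟩ := exists_potential hΓ (hext f) (by
      intro p hp
      have h5 := DFunLike.congr_fun hψ (m.symm ⟨_, p, hp, rfl⟩)
      simp only [MonoidHom.comp_apply, MulEquiv.toMonoidHom_eq_coe, MonoidHom.coe_coe,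
        MulEquiv.apply_symm_apply, Subgroup.coe_subtype, MonoidHom.one_apply] at h5
      rw [evalHom_pathClass] at h5
      exact ofAdd_eq_one.1 h5)
    refine ⟨fun v => g v, ?_⟩
    ext d
    have hbd : ∀ v, bd (fun v => g v) v = g v := fun v => by
      by_cases h : v = Γ.base
      · subst h; simp [bd, hg0]
      · simp [bd, h]
    change bd (fun v => g v) (Γ.tgt d) - bd (fun v => g v) (Γ.src d) = _
    rw [hbd, hbd, ← hg]
    simp [ext', d.2]
  have h1 := LinearMap.finrank_range_add_finrank_ker Φ
  have h2 := Submodule.finrank_mono hker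
  have h3 := LinearMap.finrank_range_le Ψ
  have h4 := Submodule.finrank_le (LinearMap.range Φ)
  simp only [Module.finrank_fintype_fun_eq_card, Fintype.card_fin] at h1 h3 h4
  have h5 : Fintype.card {v // v ≠ Γ.base} = Fintype.card Γ.V - 1 := by
    rw [Fintype.card_subtype_compl, Fintype.card_subtype_eq]
  have h6 : 0 < Fintype.card Γ.V := Fintype.card_pos_iff.2 ⟨Γ.base⟩
  rw [hcard, Nat.card_eq_fintype_card, Nat.card_eq_fintype_card]
  omega

end PalAut
namespace PalAut

open PGraph

/-! ### Components of invariant forests -/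

section Components

variable {Γ Γ' : PGraph}

/-- The component of a vertex with respect to the edges in `F`. -/
def PGraph.component (Γ : PGraph) (F : Set Γ.D) (u : Γ.V) : Set Γ.V := {v | Γ.Joined F u v}

lemma PGraph.component_eq_iff {F : Set Γ.D} (hF : ∀ d ∈ F, Γ.rev d ∈ F) {u v : Γ.V} :
    Γ.component F u = Γ.component F v ↔ Γ.Joined F u v :=
  ⟨fun h => by
    have : v ∈ Γ.component F v := Joined.refl F v
    rwa [← h] at this,
  fun h => Set.ext fun _ => ⟨fun h' => (h.symm hF).trans h', fun h' => h.trans h'⟩⟩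

/-- The components of `F` that are not invariant under `h`. -/
def movedComponents (h : GraphIso Γ Γ) (F : Set Γ.D) : Set (Set Γ.V) :=
  Γ.component F '' {u | ¬ Γ.Joined F u (h.onV u)}

/-- The number of components of `F` that are not invariant under `h`. -/
noncomputable def numMoved (h : GraphIso Γ Γ) (F : Set Γ.D) : ℕ := (movedComponents h F).ncard

lemma Joined.map {h : GraphIso Γ Γ'} {F : Set Γ.D} {F' : Set Γ'.D} (hF : ∀ d ∈ F, h.onD d ∈ F')
    {u v : Γ.V} (huv : Γ.Joined F u v) : Γ'.Joined F' (h.onV u) (h.onV v) := by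
  obtain ⟨l, hl, hk⟩ := huv
  refine ⟨_, h.isPath_map hl, fun d hd => ?_⟩
  obtain ⟨e, he, rfl⟩ := List.mem_map.1 hd
  exact hF e (hk e he)

lemma IsInvariantForest.joined_map {h : GraphIso Γ Γ} {F : Set Γ.D} (hF : IsInvariantForest h F)
    {u v : Γ.V} (huv : Γ.Joined F u v) : Γ.Joined F (h.onV u) (h.onV v) :=
  Joined.map (fun d hd => (hF.2 d).1 hd) huv

lemma even_ncard_of_involution {α : Type*} {s : Set α} (hs : s.Finite) (g : α → α)
    (hg : ∀ a ∈ s, g a ∈ s) (hne : ∀ a ∈ s, g a ≠ a) (hi : ∀ a ∈ s, g (g a) = a) :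
    Even s.ncard := by
  rw [Set.ncard_eq_toFinset_card s hs]
  have := Finset.sum_involution (s := hs.toFinset) (f := fun _ => (1 : ZMod 2))
    (fun a _ => g a) (fun a _ => by decide) (fun a ha _ => hne a (hs.mem_toFinset.1 ha))
    (fun a ha => hs.mem_toFinset.2 (hg a (hs.mem_toFinset.1 ha)))
    (fun a ha => hi a (hs.mem_toFinset.1 ha))
  rw [Finset.sum_const, nsmul_one] at this
  exact (ZMod.natCast_eq_zero_iff_even).1 this

lemma IsInvariantForest.even_numMoved {h : GraphIso Γ Γ} (hh : ∀ u, h.onV (h.onV u) = u)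
    {F : Set Γ.D} (hF : IsInvariantForest h F) : Even (numMoved h F) := by
  have := Γ.finV
  have himg : ∀ u, h.onV '' Γ.component F u = Γ.component F (h.onV u) := by
    refine fun u => Set.ext fun v => ⟨?_, fun hv => ⟨h.onV v, ?_, hh v⟩⟩
    · rintro ⟨w, hw, rfl⟩
      exact hF.joined_map hw
    · have := hF.joined_map (show Γ.Joined F (h.onV u) v from hv)
      rwa [hh] at this
  refine even_ncard_of_involution (Set.toFinite _) (fun C => h.onV '' C) ?_ ?_ ?_
  · rintro _ ⟨u, hu, rfl⟩
    refine ⟨h.onV u, fun hj => hu ?_, (himg u).symm⟩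
    have := hF.joined_map hj
    rwa [hh] at this
  · rintro _ ⟨u, hu, rfl⟩ heq
    rw [himg, component_eq_iff hF.1.1] at heq
    exact hu (heq.symm hF.1.1)
  · rintro _ ⟨u, hu, rfl⟩
    simp only [himg, hh]

/-- Enlarging an invariant forest merges two non-invariant components, or makes a pair of
non-invariant components invariant: two invariant components cannot be joined by an edge `d`, as
they would also be joined by the different edge `h d`. -/
lemma numMoved_lt {h : GraphIso Γ Γ} (hfree : ∀ d, h.onD d ≠ d) {F G : Set Γ.D}
    (hF : IsInvariantForest h F) (hG : IsInvariantForest h G) (hFG : F ⊂ G) :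
    numMoved h G < numMoved h F := by
  have := Γ.finV
  obtain ⟨hsub, d, hdG, hdF⟩ := Set.ssubset_iff_exists.1 hFG
  have hrevF : ∀ e, Γ.rev e ∈ F → e ∈ F := fun e he => Γ.rev_rev e ▸ hF.1.1 _ he
  have hhdF : h.onD d ∉ F := fun he => hdF ((hF.2 d).2 he)
  have hnj : ¬ Γ.Joined F (Γ.src d) (Γ.tgt d) := by
    intro hj
    obtain ⟨q, hq, ht, hqF⟩ := hj.exists_isTaut
    have hcl : Γ.IsPath (Γ.src d) (q ++ [Γ.rev d]) (Γ.src d) :=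
      hq.append ⟨rfl, tgt_rev d⟩
    have htaut : Γ.IsTaut (q ++ [Γ.rev d]) := by
      refine List.isChain_append.2 ⟨ht, isTaut_singleton _, fun x hx y hy => ?_⟩
      simp only [List.head?_cons, Option.mem_def, Option.some.injEq] at hy
      subst hy
      intro hxy
      exact hdF (rev_injective hxy ▸ hqF x (List.mem_of_mem_getLast? hx))
    have := hG.1.2 _ _ hcl htaut fun e he => by
      rcases List.mem_append.1 he with he | he
      · exact hsub (hqF e he)
      · rw [List.mem_singleton.1 he]; exact hG.1.1 d hdG
    simp at this
  have hrep : ∀ C ∈ movedComponents h G, ∃ u, ¬ Γ.Joined G u (h.onV u) ∧ Γ.component G u = C :=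
    fun C hC => hC
  have : Nonempty Γ.V := ⟨Γ.base⟩
  choose! r hr hrC using hrep
  have hinj : Set.InjOn (fun C => Γ.component F (r C)) (movedComponents h G) := by
    intro C hC C' hC' heq
    rw [← hrC C hC, ← hrC C' hC', component_eq_iff hG.1.1]
    exact Joined.mono hsub ((component_eq_iff hF.1.1).1 heq)
  unfold numMoved
  rw [← hinj.ncard_image]
  refine Set.ncard_lt_ncard ?_ (Set.toFinite _)
  have himgsub : (fun C => Γ.component F (r C)) '' movedComponents h G ⊆ movedComponents h F := by
    rintro _ ⟨C, hC, rfl⟩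
    exact ⟨r C, fun hj => hr C hC (hj.mono hsub), rfl⟩
  refine himgsub.ssubset_of_ne fun heq => ?_
  have hsurj : ∀ u, ¬ Γ.Joined F u (h.onV u) → ¬ Γ.Joined G u (h.onV u) ∧
      Γ.Joined F (r (Γ.component G u)) u := by
    intro u hu
    obtain ⟨C, hC, hCu⟩ : Γ.component F u ∈ (fun C => Γ.component F (r C)) '' movedComponents h G :=
      heq ▸ ⟨u, hu, rfl⟩
    have hj := (component_eq_iff hF.1.1).1 hCu
    have hCeq : Γ.component G u = C := by
      rw [← hrC C hC]; exact (component_eq_iff hG.1.1).2 ((hj.mono hsub).symm hG.1.1)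
    refine ⟨fun hju => hr C hC ?_, by rw [hCeq]; exact hj⟩
    exact ((hj.mono hsub).trans hju).trans
      ((hG.joined_map (hj.mono hsub)).symm hG.1.1)
  have hGuv : Γ.Joined G (Γ.src d) (Γ.tgt d) := Joined.edge hdG
  have hcomp := (component_eq_iff hG.1.1).2 hGuv
  by_cases hu : Γ.Joined G (Γ.src d) (h.onV (Γ.src d))
  · have hv : Γ.Joined G (Γ.tgt d) (h.onV (Γ.tgt d)) :=
      ((hGuv.symm hG.1.1).trans hu).trans (hG.joined_map hGuv)
    have hu' : Γ.Joined F (Γ.src d) (h.onV (Γ.src d)) := by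
      by_contra hc; exact (hsurj _ hc).1 hu
    have hv' : Γ.Joined F (Γ.tgt d) (h.onV (Γ.tgt d)) := by
      by_contra hc; exact (hsurj _ hc).1 hv
    obtain ⟨p, hp, hpt, hpF⟩ := hu'.exists_isTaut
    obtain ⟨q, hq, hqt, hqF⟩ := (hv'.symm hF.1.1).exists_isTaut
    have hcl : Γ.IsPath (Γ.src d) (p ++ (h.onD d :: (q ++ [Γ.rev d]))) (Γ.src d) := by
      refine hp.append ⟨h.map_src d, ?_⟩
      rw [h.map_tgt]
      exact hq.append ⟨rfl, tgt_rev d⟩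
    have htaut : Γ.IsTaut (p ++ (h.onD d :: (q ++ [Γ.rev d]))) := by
      refine List.isChain_append.2 ⟨hpt, ?_, fun x hx y hy => ?_⟩
      · cases q with
        | nil =>
          exact List.isChain_cons_cons.2 ⟨fun he => hfree d (rev_injective he).symm,
            isTaut_singleton _⟩
        | cons e q =>
          refine List.isChain_cons_cons.2 ⟨fun he => hhdF (hrevF _ (he ▸ hqF e (by simp))), ?_⟩
          refine List.isChain_append.2 ⟨hqt, isTaut_singleton _, fun x hx y hy => ?_⟩
          simp only [List.head?_cons, Option.mem_def, Option.some.injEq] at hy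
          subst hy
          intro hxy
          exact hdF (rev_injective hxy ▸ hqF x (List.mem_of_mem_getLast? hx))
      · simp only [List.head?_cons, Option.mem_def, Option.some.injEq] at hy
        subst hy
        intro hxy
        exact hhdF (hxy ▸ hF.1.1 x (hpF x (List.mem_of_mem_getLast? hx)))
    have := hG.1.2 _ _ hcl htaut fun e he => by
      rcases List.mem_append.1 he with he | he
      · exact hsub (hpF e he)
      rcases List.mem_cons.1 he with rfl | he
      · exact (hG.2 d).1 hdG
      rcases List.mem_append.1 he with he | he
      · exact hsub (hqF e he)
      · rw [List.mem_singleton.1 he]; exact hG.1.1 d hdG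
    simp at this
  · have hv : ¬ Γ.Joined G (Γ.tgt d) (h.onV (Γ.tgt d)) := fun hv =>
      hu ((hGuv.trans hv).trans ((hG.joined_map hGuv).symm hG.1.1))
    have h1 := (hsurj (Γ.src d) fun hc => hu (hc.mono hsub)).2
    have h2 := (hsurj (Γ.tgt d) fun hc => hv (hc.mono hsub)).2
    rw [hcomp] at h1
    exact hnj ((h1.symm hF.1.1).trans h2)

lemma numMoved_add_two_le {h : GraphIso Γ Γ} (hfree : ∀ d, h.onD d ≠ d)
    (hh : ∀ u, h.onV (h.onV u) = u) {F G : Set Γ.D}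
    (hF : IsInvariantForest h F) (hG : IsInvariantForest h G) (hFG : F ⊂ G) :
    numMoved h G + 2 ≤ numMoved h F := by
  obtain ⟨a, ha⟩ := hF.even_numMoved hh
  obtain ⟨b, hb⟩ := hG.even_numMoved hh
  have := numMoved_lt hfree hF hG hFG
  omega

lemma isInvariantForest_empty (h : GraphIso Γ Γ) : IsInvariantForest h ∅ :=
  ⟨⟨by simp, fun u l _ _ hk => by
    cases l with
    | nil => rfl
    | cons d l => exact absurd (hk d (by simp)) (by simp)⟩, by simp⟩

lemma Collapse.isInvariantForest_ker (c : Collapse Γ Γ') {h : GraphIso Γ Γ} {h' : GraphIso Γ' Γ'}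
    (he : ∀ d, c.onD (h.onD d) = (c.onD d).map h'.onD) : IsInvariantForest h c.ker :=
  ⟨c.isForest, fun d => by rw [mem_ker, mem_ker, he, Option.map_eq_none_iff]⟩

/-- The vertices of the collapsed graph are the components of the forest. -/
lemma Collapse.numMoved_ker (c : Collapse Γ Γ') {h : GraphIso Γ Γ} {h' : GraphIso Γ' Γ'}
    (he : ∀ u, c.onV (h.onV u) = h'.onV (c.onV u)) : numMoved h c.ker = numMoved h' ∅ := by
  have himg : ∀ u, c.onV '' Γ.component c.ker u = Γ'.component ∅ (c.onV u) := by
    refine fun u => Set.ext fun v => ⟨?_, fun hv => ?_⟩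
    · rintro ⟨w, hw, rfl⟩
      exact joined_empty_iff.2 ((c.onV_eq_iff_joined u w).2 hw)
    · exact ⟨u, PGraph.Joined.refl _ _, joined_empty_iff.1 hv⟩
  have hset : (fun C => c.onV '' C) '' movedComponents h c.ker = movedComponents h' ∅ := by
    have hiff : ∀ u, Γ.Joined c.ker u (h.onV u) ↔ Γ'.Joined ∅ (c.onV u) (h'.onV (c.onV u)) :=
      fun u => by rw [joined_empty_iff, ← he, c.onV_eq_iff_joined]
    ext C
    constructor
    · rintro ⟨_, ⟨u, hu, rfl⟩, rfl⟩
      exact ⟨c.onV u, fun hj => hu ((hiff u).2 hj), (himg u).symm⟩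
    · rintro ⟨v, hv, rfl⟩
      obtain ⟨u, rfl⟩ := c.surjective_onV v
      exact ⟨_, ⟨u, fun hj => hv ((hiff u).1 hj), rfl⟩, himg u⟩
  unfold numMoved
  rw [← hset, Set.InjOn.ncard_image]
  rintro _ ⟨u, -, rfl⟩ _ ⟨v, -, rfl⟩ heq
  simp only [himg] at heq
  rw [component_eq_iff (by simp), joined_empty_iff, c.onV_eq_iff_joined] at heq
  exact (component_eq_iff c.isForest.1).2 heq

lemma numMoved_empty (h : GraphIso Γ Γ) : numMoved h ∅ = {u | h.onV u ≠ u}.ncard := by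
  unfold numMoved movedComponents
  simp only [joined_empty_iff]
  rw [Set.InjOn.ncard_image]
  · congr 1; ext u; exact ne_comm
  · intro u _ v _ heq
    exact joined_empty_iff.1 ((component_eq_iff (by simp)).1 heq)

/-- A taut path in an invariant forest from a vertex to its image is symmetric, so it has a flipped
edge or a fixed vertex in its middle. -/
lemma IsInvariantForest.exists_flipped_or_fixed {h : GraphIso Γ Γ}
    (hhV : ∀ u, h.onV (h.onV u) = u) {F : Set Γ.D} (hF : IsInvariantForest h F) {l : List Γ.D} {u : Γ.V} (hl : Γ.IsPath u l (h.onV u))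
    (ht : Γ.IsTaut l) (hlF : ∀ d ∈ l, d ∈ F) (hne : l ≠ []) :
    ∃ d ∈ F, h.onD d = Γ.rev d ∨ h.onV (Γ.tgt d) = Γ.tgt d := by
  induction hm : l.length using Nat.strong_induction_on generalizing l u with
  | _ m ih =>
  have hcl : Γ.IsPath u (l ++ l.map h.onD) u := by
    refine hl.append ?_
    have := h.isPath_map hl
    rwa [hhV] at this
  have hnt : ¬ Γ.IsTaut (l ++ l.map h.onD) := fun hT => by
    have := hF.1.2 u _ hcl hT fun e he => by
      rcases List.mem_append.1 he with he | he
      · exact hlF e he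
      · obtain ⟨x, hx, rfl⟩ := List.mem_map.1 he
        exact (hF.2 x).1 (hlF x hx)
    simp [hne] at this
  obtain ⟨d, p, rfl⟩ := List.exists_cons_of_ne_nil hne
  rcases List.eq_nil_or_concat p with rfl | ⟨q, e, rfl⟩
  · refine ⟨d, hlF d (by simp), Or.inl ?_⟩
    by_contra hc
    exact hnt (List.isChain_cons_cons.2 ⟨hc, isTaut_singleton _⟩)
  · have hde : h.onD d = Γ.rev e := by
      by_contra hc
      refine hnt (List.isChain_append.2 ⟨ht, h.isTaut_map ht, fun x hx y hy => ?_⟩)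
      simp only [List.concat_eq_append, List.map_cons, List.head?_cons, Option.mem_def,
        Option.some.injEq] at hy
      rw [List.concat_eq_append, ← List.cons_append, List.getLast?_append] at hx
      simp only [List.getLast?_singleton, Option.some_or, Option.mem_def, Option.some.injEq] at hx
      subst hx hy
      exact hc
    have he : Γ.src e = h.onV (Γ.tgt d) := by
      rw [← h.map_tgt, hde, tgt_rev]
    rw [List.concat_eq_append] at hl ht hlF
    obtain ⟨w, hq, hw⟩ := isPath_append_iff.1 hl.2
    obtain rfl := hw.1
    by_cases hq0 : q = []
    · subst hq0
      refine ⟨d, hlF d (by simp), Or.inr ?_⟩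
      rw [← he]
      exact hq.symm
    · refine ih q.length ?_ (l := q) (u := Γ.tgt d) (he ▸ hq) ?_ ?_ hq0 rfl
      · rw [← hm]; simp
      · exact (List.isChain_append.1 ht.tail).1
      · exact fun x hx => hlF x (by simp [hx])

end Components

/-! ### Valences -/

section Valence

variable {Γ : PGraph}

lemma PGraph.sum_valence (Γ : PGraph) [Fintype Γ.V] : ∑ v, Γ.valence v = Nat.card Γ.D := by
  have := Γ.finD
  rw [← Nat.card_congr (Equiv.sigmaFiberEquiv Γ.src), Nat.card_sigma]
  rfl

/-- The darts at a fixed vertex come in pairs. -/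
lemma PGraph.IsAdmissible.four_le_valence (hΓ : Γ.IsAdmissible) {h : GraphIso Γ Γ}
    (hh : ∀ d, h.onD (h.onD d) = d) (hfree : ∀ d, h.onD d ≠ d) {v : Γ.V} (hv : h.onV v = v)
    (hb : v ≠ Γ.base) : 4 ≤ Γ.valence v := by
  have := Γ.finD
  have h3 := hΓ.valence_ne_base v hb
  have heven : Even {d | Γ.src d = v}.ncard :=
    even_ncard_of_involution (Set.toFinite _) h.onD (fun d hd => by
      rw [Set.mem_ofPred_eq] at *; rw [h.map_src, hd, hv]) (fun d _ => hfree d) fun d _ => hh d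
  have : {d | Γ.src d = v}.ncard = Γ.valence v := rfl
  rw [this] at heven
  obtain ⟨a, ha⟩ := heven
  omega

/-- The bound on the number of moved vertices, and the structure of the graphs with the largest
number of moved vertices. -/
lemma PGraph.IsAdmissible.numMoved_empty_le {n : ℕ} (hΓ : Γ.IsAdmissible) {h : GraphIso Γ Γ}
    (hh : ∀ d, h.onD (h.onD d) = d) (hfree : ∀ d, h.onD d ≠ d)
    (hcard : Nat.card Γ.D + 2 ≤ 2 * Nat.card Γ.V + 2 * n) :
    numMoved h ∅ + 2 ≤ 2 * n ∧ (numMoved h ∅ + 2 = 2 * n →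
      (∀ u, h.onV u = u → u = Γ.base) ∧ Γ.valence Γ.base = 2 ∧
        ∀ u, u ≠ Γ.base → Γ.valence u = 3) := by
  classical
  have := Γ.finV
  have := Γ.finD
  have := Fintype.ofFinite Γ.V
  set w : Γ.V → ℕ := fun v => if v = Γ.base then 2 else if h.onV v = v then 4 else 3 with hw
  have hle : ∀ v ∈ Finset.univ, w v ≤ Γ.valence v := fun v _ => by
    simp only [hw]
    split_ifs with h1 h2
    · rw [h1]; exact hΓ.valence_base
    · exact hΓ.four_le_valence hh hfree h2 h1
    · exact hΓ.valence_ne_base v h1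
  have hsum := Finset.sum_le_sum hle
  rw [Γ.sum_valence] at hsum
  have hwsum : ∑ v, w v + 2 = 3 * Fintype.card Γ.V + {u | h.onV u = u}.ncard := by
    have h1 : ∀ v, w v + (if v = Γ.base then 2 else 0) = 3 + if h.onV v = v then 1 else 0 := by
      intro v
      simp only [hw]
      split_ifs with h1 h2 h2
      · rfl
      · rw [h1, h.map_base] at h2; exact absurd rfl h2
      · rfl
      · rfl
    have h2 : ∑ v, (w v + if v = Γ.base then 2 else 0) =
        ∑ v, (3 + if h.onV v = v then 1 else 0) := Finset.sum_congr rfl fun v _ => h1 v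
    rw [Finset.sum_add_distrib, Finset.sum_add_distrib, Finset.sum_ite_eq' ] at h2
    simp only [Finset.mem_univ, if_true, Finset.sum_const, Finset.card_univ, smul_eq_mul,
      Finset.sum_boole, Nat.cast_id] at h2
    rw [h2, Set.ncard_eq_toFinset_card', mul_comm]
    congr 2
    ext; simp
  have hsplit : numMoved h ∅ + {u | h.onV u = u}.ncard = Fintype.card Γ.V := by
    rw [numMoved_empty, ← Nat.card_eq_fintype_card, add_comm]
    exact Set.ncard_add_ncard_compl {u | h.onV u = u}
  have hfix : 1 ≤ {u | h.onV u = u}.ncard :=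
    (Set.ncard_pos (Set.toFinite _)).2 ⟨Γ.base, h.map_base⟩
  rw [Nat.card_eq_fintype_card (α := Γ.V)] at hcard
  refine ⟨by omega, fun heq => ?_⟩
  have h1 : {u | h.onV u = u}.ncard = 1 := by omega
  obtain ⟨b, hb⟩ := Set.ncard_eq_one.1 h1
  have hbase : ∀ u, h.onV u = u → u = Γ.base := by
    have h2 : Γ.base ∈ {u | h.onV u = u} := h.map_base
    rw [hb] at h2
    intro u hu
    have h3 : u ∈ {u | h.onV u = u} := hu
    rw [hb] at h3
    exact h3.trans h2.symm
  have hall := (Finset.sum_eq_sum_iff_of_le hle).1 (by rw [Γ.sum_valence]; omega)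
  refine ⟨hbase, ?_, fun u hu => ?_⟩
  · rw [← hall _ (Finset.mem_univ _)]; simp [hw]
  · rw [← hall _ (Finset.mem_univ _)]
    simp only [hw, if_neg hu]
    rw [if_neg fun h' => hu (hbase u h')]

end Valence

end PalAut
namespace PalAut

open PGraph

/-! ### Isomorphisms of collapsed graphs -/

lemma exists_equiv_of_rel {α β : Type*} (R : α → β → Prop) (h1 : ∀ a, ∃! b, R a b)
    (h2 : ∀ b, ∃! a, R a b) : ∃ e : α ≃ β, ∀ a, R a (e a) := by
  choose f hf hfu using h1
  choose g hg hgu using h2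
  exact ⟨⟨f, g, fun a => (hgu _ _ (hf a)).symm, fun b => (hfu _ _ (hg b)).symm⟩, hf⟩

/-- An isomorphism of pointed graphs, from relations between the vertices and between the edges
that are graphs of bijections. -/
lemma GraphIso.exists_of_rel {Γ Γ' : PGraph} (RV : Γ.V → Γ'.V → Prop) (RD : Γ.D → Γ'.D → Prop)
    (hV : ∀ u, ∃! v, RV u v) (hV' : ∀ v, ∃! u, RV u v) (hD : ∀ d, ∃! e, RD d e)
    (hD' : ∀ e, ∃! d, RD d e) (hsrc : ∀ d e, RD d e → RV (Γ.src d) (Γ'.src e))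
    (hrev : ∀ d e, RD d e → RD (Γ.rev d) (Γ'.rev e)) (hbase : RV Γ.base Γ'.base) :
    ∃ k : GraphIso Γ Γ', ∀ d, RD d (k.onD d) := by
  obtain ⟨eV, heV⟩ := exists_equiv_of_rel RV hV hV'
  obtain ⟨eD, heD⟩ := exists_equiv_of_rel RD hD hD'
  exact ⟨⟨eV, eD, fun d => (hV _).unique (hsrc _ _ (heD d)) (heV _),
    fun d => (hD _).unique (hrev _ _ (heD d)) (heD _), (hV _).unique (heV _) hbase⟩, heD⟩

namespace Collapse

variable {Γ Γ' Γ₁ Γ₁' : PGraph}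

lemma map_map_of_onD {b : Collapse Γ Γ₁} {b' : Collapse Γ' Γ₁'} {t : GraphIso Γ Γ'}
    {k : GraphIso Γ₁ Γ₁'} (hk : ∀ d, b'.onD (t.onD d) = (b.onD d).map k.onD) (w : Γ.PathGroup) :
    k.map (b.map w) = b'.map (t.map w) := by
  have : k.map.comp b.map = b'.map.comp t.map := PresentedGroup.ext fun d => by
    change k.map (b.map (Γ.edge d)) = b'.map (t.map (Γ.edge d))
    rw [map_edge, t.map_edge, map_edge, hk]
    cases b.onD d with
    | none => simp
    | some x => exact k.map_edge x
  exact DFunLike.congr_fun this w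

lemma exists_iso_of_ker_eq {b : Collapse Γ Γ₁} {b' : Collapse Γ Γ₁'} (h : b.ker = b'.ker) :
    ∃ k : GraphIso Γ₁ Γ₁', ∀ d, b'.onD d = (b.onD d).map k.onD := by
  have key : ∀ {Γ₁ Γ₁' : PGraph} (b : Collapse Γ Γ₁) (b' : Collapse Γ Γ₁'), b.ker = b'.ker →
      (∀ v, ∃! v', ∃ u, b.onV u = v ∧ b'.onV u = v') ∧
      ∀ x, ∃! x', ∃ d, b.onD d = some x ∧ b'.onD d = some x' := by
    intro Γ₁ Γ₁' b b' h
    refine ⟨fun v => ?_, fun x => ?_⟩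
    · obtain ⟨u, rfl⟩ := b.surjective_onV v
      refine ⟨b'.onV u, ⟨u, rfl, rfl⟩, ?_⟩
      rintro _ ⟨u', hu', rfl⟩
      rwa [b.onV_eq_iff_joined, h, ← b'.onV_eq_iff_joined] at hu'
    · obtain ⟨d, hd⟩ := b.exists_onD x
      have hd' : d ∉ b'.ker := by rw [← h, mem_ker, hd]; simp
      obtain ⟨x', hx'⟩ := exists_of_notMem_ker hd'
      refine ⟨x', ⟨d, hd, hx'⟩, ?_⟩
      rintro y ⟨e, he, hy⟩
      obtain rfl := b.onD_inj hd he
      exact Option.some.inj (hy.symm.trans hx')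
  obtain ⟨hV, hD⟩ := key b b' h
  obtain ⟨hV', hD'⟩ := key b' b h.symm
  obtain ⟨k, hk⟩ := GraphIso.exists_of_rel (fun v v' => ∃ u, b.onV u = v ∧ b'.onV u = v')
    (fun x x' => ∃ d, b.onD d = some x ∧ b'.onD d = some x') hV
    (by simpa only [and_comm] using hV') hD (by simpa only [and_comm] using hD')
    (by
      rintro x x' ⟨d, hx, hx'⟩
      exact ⟨Γ.src d, (b.map_src _ _ hx).symm, (b'.map_src _ _ hx').symm⟩)
    (by
      rintro x x' ⟨d, hx, hx'⟩
      exact ⟨Γ.rev d, b.onD_rev hx, b'.onD_rev hx'⟩)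
    ⟨Γ.base, b.map_base, b'.map_base⟩
  refine ⟨k, fun d => ?_⟩
  cases hd : b.onD d with
  | none =>
    have : d ∈ b'.ker := h ▸ hd
    exact this
  | some x =>
    obtain ⟨e, he, he'⟩ := hk x
    obtain rfl := b.onD_inj hd he
    exact he'

/-- An isomorphism that respects the forests of two collapses induces an isomorphism of the
collapsed graphs. -/
lemma exists_iso_over {b : Collapse Γ Γ₁} {b' : Collapse Γ' Γ₁'} {t : GraphIso Γ Γ'}
    (h : ∀ d, t.onD d ∈ b'.ker ↔ d ∈ b.ker) :
    ∃ k : GraphIso Γ₁ Γ₁', ∀ w, k.map (b.map w) = b'.map (t.map w) := by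
  obtain ⟨k, hk⟩ := exists_iso_of_ker_eq (b := b) (b' := b'.comp t.toCollapse)
    (Set.ext fun d => (h d).symm)
  exact ⟨k, map_map_of_onD hk⟩

lemma mem_ker_comp {c' : Collapse Γ' Γ₁} {c : Collapse Γ Γ'} {d : Γ.D} :
    d ∈ (c'.comp c).ker ↔ d ∈ c.ker ∨ ∃ x ∈ c'.ker, c.onD d = some x := by
  change (c.onD d).bind c'.onD = none ↔ _
  cases hd : c.onD d <;> simp [mem_ker, hd]

end Collapse

/-! ### Collapses of marked graphs -/

variable {n : ℕ}

/-- A collapse that takes one marking to the other. -/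
def Collapse.IsMarked {M N : MarkedGraph n} (c : Collapse N.graph M.graph) : Prop :=
  ∀ w, c.map (N.mark w) = M.mark w

lemma MarkedGraph.exists_iso {M N : MarkedGraph n} (h : M.toSpine = N.toSpine) :
    ∃ k : GraphIso M.graph N.graph, ∀ w, k.map (M.mark w) = N.mark w := Quotient.exact h

lemma MarkedGraph.toSpine_eq {M N : MarkedGraph n} (k : GraphIso M.graph N.graph)
    (hk : ∀ w, k.map (M.mark w) = N.mark w) : M.toSpine = N.toSpine := Quotient.sound ⟨k, hk⟩

namespace Collapse

variable {M N P : MarkedGraph n}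

lemma IsMarked.comp {c : Collapse N.graph M.graph} {c' : Collapse P.graph N.graph}
    (hc : c.IsMarked) (hc' : c'.IsMarked) : (c.comp c').IsMarked := fun w => by
  rw [comp_map, hc', hc]

lemma isMarked_toCollapse {k : GraphIso M.graph N.graph} (hk : ∀ w, k.map (M.mark w) = N.mark w) :
    k.toCollapse.IsMarked := fun w => by rw [k.toCollapse_map, hk]

lemma IsMarked.map_eq {c c' : Collapse N.graph M.graph} (hc : c.IsMarked) (hc' : c'.IsMarked) :
    ∀ w ∈ N.graph.pi1, c.map w = c'.map w := by
  intro w hw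
  obtain ⟨x, hx⟩ := N.mark.surjective ⟨w, hw⟩
  have hx' : w = N.mark x := by rw [hx]
  rw [hx', hc, hc']

lemma IsMarked.onD_eq {c c' : Collapse N.graph M.graph} (hc : c.IsMarked) (hc' : c'.IsMarked) :
    c.onD = c'.onD := onD_eq_of_map_eq N.admissible (hc.map_eq hc')

lemma IsMarked.ker_eq {c c' : Collapse N.graph M.graph} (hc : c.IsMarked) (hc' : c'.IsMarked) :
    c.ker = c'.ker := by rw [ker, ker, hc.onD_eq hc']

/-- A collapse of marked graphs commutes with the involutions, since it does so on the fundamental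
group. -/
lemma IsMarked.equivariant {c : Collapse N.graph M.graph} (hc : c.IsMarked)
    {k : GraphIso N.graph N.graph} (hk : Realizes N k) {h : GraphIso M.graph M.graph}
    (hh : Realizes M h) : (∀ d, c.onD (k.onD d) = (c.onD d).map h.onD) ∧
      ∀ u, c.onV (k.onV u) = h.onV (c.onV u) := by
  have hmap : ∀ w ∈ N.graph.pi1, (c.comp k.toCollapse).map w = (h.toCollapse.comp c).map w := by
    intro w hw
    obtain ⟨x, hx⟩ := N.mark.surjective ⟨w, hw⟩
    have hx' : w = N.mark x := by rw [hx]
    rw [hx', comp_map, comp_map, k.toCollapse_map, h.toCollapse_map, hk, hc, hc, hh]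
  have h1 := onD_eq_of_map_eq N.admissible hmap
  have h2 := onV_eq_of_map_eq N.admissible hmap
  refine ⟨fun d => (congrFun h1 d).trans ?_, fun u => congrFun h2 u⟩
  change (c.onD d).bind (fun x => some (h.onD x)) = _
  cases c.onD d <;> rfl

lemma IsMarked.toSpine_eq_of_ker_eq {M' : MarkedGraph n} {c : Collapse N.graph M.graph}
    {c' : Collapse N.graph M'.graph} (hc : c.IsMarked) (hc' : c'.IsMarked) (h : c.ker = c'.ker) :
    M.toSpine = M'.toSpine := by
  obtain ⟨k, hk⟩ := exists_iso_over (b := c) (b' := c') (t := GraphIso.refl _)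
    (fun d => by rw [h]; rfl)
  refine MarkedGraph.toSpine_eq k fun w => ?_
  rw [← hc, hk, GraphIso.map_refl, hc']

end Collapse

lemma Spine.Below.exists_collapse {x y : Spine n} (h : Spine.Below x y) {M N : MarkedGraph n}
    (hM : M.toSpine = x) (hN : N.toSpine = y) :
    ∃ c : Collapse N.graph M.graph, c.IsMarked ∧ c.ker.Nonempty := by
  obtain ⟨M', N', hM', hN', c, ⟨d, hd⟩, hc⟩ := h
  obtain ⟨a, ha⟩ := MarkedGraph.exists_iso (hM'.trans hM.symm)
  obtain ⟨b, hb⟩ := MarkedGraph.exists_iso (hN.trans hN'.symm)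
  have hc : c.IsMarked := hc
  refine ⟨a.toCollapse.comp (c.comp b.toCollapse), (Collapse.isMarked_toCollapse ha).comp
    (hc.comp (Collapse.isMarked_toCollapse hb)), b.onD.symm d, ?_⟩
  rw [Collapse.mem_ker_comp, Collapse.mem_ker_comp]
  exact Or.inl (Or.inr ⟨d, hd, by simp [GraphIso.toCollapse]⟩)

/-! ### Automorphisms of `F_n` from automorphisms of marked graphs -/

lemma GraphIso.map_mem_pi1 {Γ Γ' : PGraph} (h : GraphIso Γ Γ') {w : Γ.PathGroup} (hw : w ∈ Γ.pi1) :
    h.map w ∈ Γ'.pi1 := by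
  obtain ⟨l, hl, rfl⟩ := hw
  refine ⟨l.map h.onD, ?_, ?_⟩
  · have := h.isPath_map hl
    rwa [h.map_base] at this
  · rw [← h.toCollapse_map, Collapse.map_pathClass]
    congr 1
    exact (List.filterMap_eq_map (f := h.onD) ▸ rfl : l.filterMap (some ∘ h.onD) = _).symm

/-- The isomorphism of fundamental groups induced by an isomorphism of pointed graphs. -/
def GraphIso.pi1Equiv {Γ Γ' : PGraph} (h : GraphIso Γ Γ') : Γ.pi1 ≃* Γ'.pi1 where
  toFun w := ⟨h.map w, h.map_mem_pi1 w.2⟩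
  invFun w := ⟨h.symm.map w, h.symm.map_mem_pi1 w.2⟩
  left_inv _ := Subtype.ext (h.map_symm_map _)
  right_inv _ := Subtype.ext (h.symm.map_symm_map _)
  map_mul' _ _ := Subtype.ext (map_mul _ _ _)

/-- An automorphism of a marked graph that commutes with the involution is realized by a
palindromic automorphism. -/
lemma Realizes.exists_PiA {M : MarkedGraph n} {h : GraphIso M.graph M.graph} (hr : Realizes M h)
    {t : GraphIso M.graph M.graph} (ht : ∀ d, t.onD (h.onD d) = h.onD (t.onD d)) :
    ∃ g : PiA n, ∀ w, t.map (M.mark w) = M.mark ((g : MulAut (FreeGroup (Fin n))) w) := by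
  set g : MulAut (FreeGroup (Fin n)) := (M.mark.trans t.pi1Equiv).trans M.mark.symm with hg
  have hgm : ∀ w, t.map (M.mark w) = M.mark (g w) := fun w => by
    simp [hg, GraphIso.pi1Equiv]
  have hcomm : ∀ w, t.map (h.map w) = h.map (t.map w) := by
    have : t.map.comp h.map = h.map.comp t.map := PresentedGroup.ext fun d => by
      change t.map (h.map (M.graph.edge d)) = h.map (t.map (M.graph.edge d))
      simp only [GraphIso.map_edge, ht]
    exact DFunLike.congr_fun this
  refine ⟨⟨g, mem_PiA_iff.2 ?_⟩, hgm⟩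
  ext w
  refine M.mark.injective (Subtype.ext ?_)
  change (M.mark (sigma n (g w)) : M.graph.PathGroup) = M.mark (g (sigma n w))
  rw [← hgm, ← hr, ← hr, ← hgm, hcomm]

section Orbit

variable {W : MarkedGraph n} {t : GraphIso W.graph W.graph} {g : MulAut (FreeGroup (Fin n))}

lemma smul_toSpine_eq_self (hg : ∀ w, t.map (W.mark w) = W.mark (g w)) {M : MarkedGraph n}
    {b : Collapse W.graph M.graph} (hb : b.IsMarked) (h : ∀ d, t.onD d ∈ b.ker ↔ d ∈ b.ker) :
    g • M.toSpine = M.toSpine := by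
  obtain ⟨k, hk⟩ := Collapse.exists_iso_over h
  rw [smul_toSpine]
  refine MarkedGraph.toSpine_eq (M := M.twist g) k fun w => ?_
  change k.map (M.mark (g⁻¹ w)) = M.mark w
  rw [← hb, hk, hg, hb]
  simp

lemma smul_toSpine_eq (hg : ∀ w, t.map (W.mark w) = W.mark (g w)) {Z Z' : MarkedGraph n}
    {c : Collapse Z.graph W.graph} (hc : c.IsMarked) {c' : Collapse Z'.graph W.graph}
    (hc' : c'.IsMarked) {f : GraphIso Z.graph Z'.graph}
    (hf : ∀ d, c'.onD (f.onD d) = (c.onD d).map t.onD) : g • Z.toSpine = Z'.toSpine := by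
  rw [smul_toSpine]
  refine MarkedGraph.toSpine_eq (M := Z.twist g) f fun w => ?_
  change f.map (Z.mark (g⁻¹ w)) = Z'.mark w
  obtain ⟨y, hy⟩ := Z'.mark.surjective ⟨_, f.map_mem_pi1 (Z.mark (g⁻¹ w)).2⟩
  have hy' : f.map (Z.mark (g⁻¹ w)) = Z'.mark y := by rw [hy]
  rw [hy']
  have h1 := Collapse.map_map_of_onD hf (Z.mark (g⁻¹ w))
  rw [hy', hc, hc', hg] at h1
  have h2 := W.mark.injective (Subtype.ext h1)
  rw [← h2]
  simp

end Orbit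

end PalAut
namespace PalAut

open PGraph

/-! ### Collapses of a single orbit of edges at a leaf of the quotient tree -/

/-- An edge that is flipped by the involution, or that is adjacent to the base.  These are the
edges that lie over an edge of the quotient tree adjacent to a branch point. -/
def IsLeafEdge {Γ : PGraph} (h : GraphIso Γ Γ) (d : Γ.D) : Prop :=
  h.onD d = Γ.rev d ∨ Γ.src d = Γ.base ∨ Γ.tgt d = Γ.base

/-- The graphs in which every branch point of the quotient map is a leaf of the quotient tree and
all other vertices of the tree are trivalent. -/
structure IsTrivalent {Γ : PGraph} (h : GraphIso Γ Γ) : Prop where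
  eq_base : ∀ u, h.onV u = u → u = Γ.base
  valence_base : Γ.valence Γ.base = 2
  valence_eq : ∀ u, u ≠ Γ.base → Γ.valence u = 3

/-- The collapse `c` collapses the orbit of the edge `d₀`, which lies over an edge of the quotient
tree that joins the trivalent vertex under `src d₀` to a leaf; `v` is the image of this edge.  The
leaf is either the midpoint of the flipped edge `d₀` or the base. -/
structure IsLeafCollapse {Γ Δ : PGraph} (c : Collapse Γ Δ) (h : GraphIso Γ Γ) (k : GraphIso Δ Δ)
    (v : Δ.V) (d₀ : Γ.D) : Prop where
  mem_ker_iff : ∀ d, d ∈ c.ker ↔ d = d₀ ∨ d = Γ.rev d₀ ∨ d = h.onD d₀ ∨ d = Γ.rev (h.onD d₀)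
  onD_onD : ∀ d, h.onD (h.onD d) = d
  onV_onV : ∀ u, h.onV (h.onV u) = u
  equivD : ∀ d, c.onD (h.onD d) = (c.onD d).map k.onD
  equivV : ∀ u, c.onV (h.onV u) = k.onV (c.onV u)
  src_ne : h.onV (Γ.src d₀) ≠ Γ.src d₀
  type : (v ≠ Δ.base ∧ h.onD d₀ = Γ.rev d₀) ∨ (v = Δ.base ∧ Γ.tgt d₀ = Γ.base)
  fiber : ∀ u, c.onV u = v ↔ u = Γ.src d₀ ∨ u = h.onV (Γ.src d₀) ∨ u = Γ.tgt d₀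
  inj : ∀ u u', c.onV u = c.onV u' → c.onV u ≠ v → u = u'
  src_of_notMem_ker : ∀ d, d ∉ c.ker → c.onV (Γ.src d) = v →
    Γ.src d = Γ.src d₀ ∨ Γ.src d = h.onV (Γ.src d₀)

namespace IsLeafCollapse

variable {Γ Γ' Δ : PGraph} {c : Collapse Γ Δ} {h : GraphIso Γ Γ} {k : GraphIso Δ Δ} {v : Δ.V}
  {d₀ : Γ.D} {c' : Collapse Γ' Δ} {h' : GraphIso Γ' Γ'} {d₀' : Γ'.D}

lemma src_ne_base (P : IsLeafCollapse c h k v d₀) : Γ.src d₀ ≠ Γ.base := fun hb =>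
  P.src_ne (by rw [hb, h.map_base])

lemma onV_src_ne_base (P : IsLeafCollapse c h k v d₀) : h.onV (Γ.src d₀) ≠ Γ.base := fun hb =>
  P.src_ne_base (h.onV.injective (hb.trans h.map_base.symm))

lemma tgt_of_flip (_ : IsLeafCollapse c h k v d₀) (hf : h.onD d₀ = Γ.rev d₀) :
    Γ.tgt d₀ = h.onV (Γ.src d₀) := by
  rw [← h.map_src, hf]; rfl

lemma flip_iff (P : IsLeafCollapse c h k v d₀) (P' : IsLeafCollapse c' h' k v d₀') :
    h.onD d₀ = Γ.rev d₀ ↔ h'.onD d₀' = Γ'.rev d₀' := by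
  have key : ∀ {Γ : PGraph} {c : Collapse Γ Δ} {h : GraphIso Γ Γ} {d₀ : Γ.D},
      IsLeafCollapse c h k v d₀ → (h.onD d₀ = Γ.rev d₀ ↔ v ≠ Δ.base) := by
    intro Γ c h d₀ P
    refine ⟨fun hf => ?_, fun hv => (P.type.resolve_right fun h => hv h.1).2⟩
    refine P.type.elim And.left fun h => absurd ?_ P.onV_src_ne_base
    rw [← P.tgt_of_flip hf, h.2]
  rw [key P, key P']

/-- Replacing the edge by its image under the involution. -/
lemma swap (P : IsLeafCollapse c h k v d₀) : IsLeafCollapse c h k v (h.onD d₀) where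
  mem_ker_iff d := by rw [P.mem_ker_iff, P.onD_onD]; tauto
  onD_onD := P.onD_onD
  onV_onV := P.onV_onV
  equivD := P.equivD
  equivV := P.equivV
  src_ne := by rw [h.map_src, P.onV_onV]; exact P.src_ne.symm
  type := P.type.imp (fun ⟨h1, h2⟩ => ⟨h1, by rw [P.onD_onD, h2, Γ.rev_rev]⟩)
    fun ⟨h1, h2⟩ => ⟨h1, by rw [h.map_tgt, h2, h.map_base]⟩
  fiber u := by
    rw [P.fiber, h.map_src, P.onV_onV, h.map_tgt]
    rcases P.type with ⟨-, hf⟩ | ⟨-, hb⟩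
    · rw [P.tgt_of_flip hf, P.onV_onV]; tauto
    · rw [hb, h.map_base]; tauto
  inj := P.inj
  src_of_notMem_ker d hd hv := by
    rw [h.map_src, P.onV_onV]; exact (P.src_of_notMem_ker d hd hv).symm

/-- Corresponding edges of two leaf collapses with the same target, over an automorphism `t` of the
target. -/
def EdgeRel (c : Collapse Γ Δ) (h : GraphIso Γ Γ) (d₀ : Γ.D) (c' : Collapse Γ' Δ)
    (h' : GraphIso Γ' Γ') (d₀' : Γ'.D) (t : GraphIso Δ Δ) (d : Γ.D) (e : Γ'.D) : Prop :=
  (∃ x, c.onD d = some x ∧ c'.onD e = some (t.onD x)) ∨ (d = d₀ ∧ e = d₀') ∨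
    (d = Γ.rev d₀ ∧ e = Γ'.rev d₀') ∨ (d = h.onD d₀ ∧ e = h'.onD d₀') ∨
    (d = Γ.rev (h.onD d₀) ∧ e = Γ'.rev (h'.onD d₀'))

/-- Corresponding vertices of two leaf collapses with the same target, over an automorphism `t` of
the target. -/
def VertexRel (c : Collapse Γ Δ) (h : GraphIso Γ Γ) (d₀ : Γ.D) (c' : Collapse Γ' Δ)
    (h' : GraphIso Γ' Γ') (d₀' : Γ'.D) (t : GraphIso Δ Δ) (v : Δ.V) (u : Γ.V) (w : Γ'.V) : Prop :=
  (u = Γ.src d₀ ∧ w = Γ'.src d₀') ∨ (u = h.onV (Γ.src d₀) ∧ w = h'.onV (Γ'.src d₀')) ∨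
    (u = Γ.base ∧ w = Γ'.base) ∨ (c.onV u ≠ v ∧ c'.onV w = t.onV (c.onV u))

variable {t : GraphIso Δ Δ}

lemma existsUnique_edgeRel (P : IsLeafCollapse c h k v d₀) (P' : IsLeafCollapse c' h' k v d₀')
    (d : Γ.D) : ∃! e, EdgeRel c h d₀ c' h' d₀' t d e := by
  by_cases hd : d ∈ c.ker
  · have hno : ∀ x, c.onD d ≠ some x := fun x hx => by rw [Collapse.mem_ker, hx] at hd; cases hd
    have hflip := P.flip_iff P'
    have n1 := Γ.rev_ne d₀
    have n2 : h.onD d₀ ≠ d₀ := fun he => P.src_ne (by rw [← h.map_src, he])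
    have r1 := Γ.rev_rev d₀
    have r2 := Γ.rev_rev (h.onD d₀)
    have r3 := Γ'.rev_rev d₀'
    have r4 := Γ'.rev_rev (h'.onD d₀')
    have n3 := Γ.rev_ne (h.onD d₀)
    simp only [EdgeRel, hno, false_and, exists_false, false_or]
    rcases (P.mem_ker_iff d).1 hd with hd | hd | hd | hd
    · exact ⟨d₀', by grind, by grind⟩
    · exact ⟨Γ'.rev d₀', by grind, by grind⟩
    · exact ⟨h'.onD d₀', by grind, by grind⟩
    · exact ⟨Γ'.rev (h'.onD d₀'), by grind, by grind⟩
  · obtain ⟨x, hx⟩ := Collapse.exists_of_notMem_ker hd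
    obtain ⟨e, he⟩ := c'.exists_onD (t.onD x)
    refine ⟨e, Or.inl ⟨x, hx, he⟩, ?_⟩
    rintro e' (⟨x', hx', he'⟩ | ho)
    · rw [hx, Option.some.injEq] at hx'
      subst hx'
      exact c'.onD_inj he' he
    · exact absurd ((P.mem_ker_iff d).2 (by tauto)) hd

lemma existsUnique_vertexRel (P : IsLeafCollapse c h k v d₀) (P' : IsLeafCollapse c' h' k v d₀')
    (htv : t.onV v = v) (u : Γ.V) : ∃! w, VertexRel c h d₀ c' h' d₀' t v u w := by
  have hcb : ∀ w, c.onV u ≠ v → u = Γ.base → c'.onV w = t.onV (c.onV u) → w = Γ'.base := by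
    intro w hu hb hw
    subst hb
    have h1 : t.onV (c.onV Γ.base) = c'.onV Γ'.base := by
      rw [c.map_base, t.map_base, c'.map_base]
    refine P'.inj _ _ (hw.trans h1) fun hv => hu (t.onV.injective ?_)
    rw [← hw, hv, htv]
  have hsrc : c.onV (Γ.src d₀) = v := (P.fiber _).2 (Or.inl rfl)
  have hsrc' : c.onV (h.onV (Γ.src d₀)) = v := (P.fiber _).2 (Or.inr (Or.inl rfl))
  refine existsUnique_of_exists_of_unique ?_ ?_
  · by_cases hu : c.onV u = v
    · rcases (P.fiber u).1 hu with h1 | h1 | h1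
      · exact ⟨_, Or.inl ⟨h1, rfl⟩⟩
      · exact ⟨_, Or.inr (Or.inl ⟨h1, rfl⟩)⟩
      · rcases P.type with ⟨-, hf⟩ | ⟨-, hb⟩
        · exact ⟨_, Or.inr (Or.inl ⟨h1.trans (P.tgt_of_flip hf), rfl⟩)⟩
        · exact ⟨_, Or.inr (Or.inr (Or.inl ⟨h1.trans hb, rfl⟩))⟩
    · obtain ⟨w, hw⟩ := c'.surjective_onV (t.onV (c.onV u))
      exact ⟨w, Or.inr (Or.inr (Or.inr ⟨hu, hw⟩))⟩
  · rintro w w' (⟨h1, h2⟩ | ⟨h1, h2⟩ | ⟨h1, h2⟩ | ⟨h1, h2⟩) (⟨h3, h4⟩ | ⟨h3, h4⟩ | ⟨h3, h4⟩ | ⟨h3, h4⟩)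
    · rw [h2, h4]
    · exact absurd (h3.symm.trans h1) P.src_ne
    · exact absurd (h1.symm.trans h3) P.src_ne_base
    · exact absurd (h1 ▸ hsrc) h3
    · exact absurd (h1.symm.trans h3) P.src_ne
    · rw [h2, h4]
    · exact absurd (h1.symm.trans h3) P.onV_src_ne_base
    · exact absurd (h1 ▸ hsrc') h3
    · exact absurd (h3.symm.trans h1) P.src_ne_base
    · exact absurd (h3.symm.trans h1) P.onV_src_ne_base
    · rw [h2, h4]
    · rw [h2, hcb w' h3 h1 h4]
    · exact absurd (h3 ▸ hsrc) h1
    · exact absurd (h3 ▸ hsrc') h1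
    · rw [h4, hcb w h1 h3 h2]
    · refine P'.inj _ _ (h2.trans h4.symm) fun hv => h1 (t.onV.injective ?_)
      rw [← h2, hv, htv]

lemma edgeRel_symm (d : Γ.D) (e : Γ'.D) : EdgeRel c' h' d₀' c h d₀ t.symm e d ↔ EdgeRel c h d₀ c' h' d₀' t d e := by
  unfold EdgeRel
  refine or_congr ⟨?_, ?_⟩ (by tauto)
  · rintro ⟨y, hy, hd⟩
    exact ⟨_, hd, by rw [hy]; simp [GraphIso.symm]⟩
  · rintro ⟨x, hx, he⟩
    exact ⟨_, he, by rw [hx]; simp [GraphIso.symm]⟩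

lemma vertexRel_symm (htv : t.onV v = v) (u : Γ.V) (w : Γ'.V) :
    VertexRel c' h' d₀' c h d₀ t.symm v w u ↔ VertexRel c h d₀ c' h' d₀' t v u w := by
  unfold VertexRel
  refine or_congr (by tauto) (or_congr (by tauto) (or_congr (by tauto) ⟨?_, ?_⟩))
  · rintro ⟨h1, h2⟩
    have h3 : t.onV (c.onV u) = c'.onV w := by rw [h2]; simp [GraphIso.symm]
    exact ⟨fun hv => h1 (by rw [← h3, hv, htv]), h3.symm⟩
  · rintro ⟨h1, h2⟩
    refine ⟨fun hv => h1 (t.onV.injective ?_), by rw [h2]; simp [GraphIso.symm]⟩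
    rw [← h2, hv, htv]

/-- Two leaf collapses with the same target are isomorphic over an automorphism `t` of the target
if `t` takes the edges that come from `src d₀` to those that come from `src d₀'`. -/
lemma exists_iso (P : IsLeafCollapse c h k v d₀) (P' : IsLeafCollapse c' h' k v d₀')
    (htv : t.onV v = v) (hT : ∀ d e x, c.onD d = some x → c'.onD e = some (t.onD x) →
      c.onV (Γ.src d) = v → (Γ.src d = Γ.src d₀ ↔ Γ'.src e = Γ'.src d₀')) :
    ∃ f : GraphIso Γ Γ', ∀ d, c'.onD (f.onD d) = (c.onD d).map t.onD := by
  have htv' : t.symm.onV v = v := by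
    change t.onV.symm v = v
    rw [Equiv.symm_apply_eq, htv]
  have hsrc : ∀ d e, EdgeRel c h d₀ c' h' d₀' t d e →
      VertexRel c h d₀ c' h' d₀' t v (Γ.src d) (Γ'.src e) := by
    rintro d e (⟨x, hx, he⟩ | ho)
    · have h1 : c.onV (Γ.src d) = Δ.src x := (c.map_src _ _ hx).symm
      have h2 : c'.onV (Γ'.src e) = t.onV (Δ.src x) := by
        rw [← t.map_src]; exact (c'.map_src _ _ he).symm
      by_cases hv : c.onV (Γ.src d) = v
      · have hiff := hT d e x hx he hv
        rcases P.src_of_notMem_ker d (by rw [Collapse.mem_ker, hx]; simp) hv with h3 | h3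
        · exact Or.inl ⟨h3, hiff.1 h3⟩
        · refine Or.inr (Or.inl ⟨h3, ?_⟩)
          refine (P'.src_of_notMem_ker e (by rw [Collapse.mem_ker, he]; simp) ?_).resolve_left
            fun h4 => P.src_ne (h3.symm.trans (hiff.2 h4))
          rw [h2, ← h1, hv, htv]
      · exact Or.inr (Or.inr (Or.inr ⟨hv, by rw [h2, h1]⟩))
    · have htgt : VertexRel c h d₀ c' h' d₀' t v (Γ.tgt d₀) (Γ'.tgt d₀') ∧
          VertexRel c h d₀ c' h' d₀' t v (h.onV (Γ.tgt d₀)) (h'.onV (Γ'.tgt d₀')) := by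
        rcases P.type with ⟨-, hf⟩ | ⟨hv, hb⟩
        · rw [P.tgt_of_flip hf, P'.tgt_of_flip ((P.flip_iff P').1 hf), P.onV_onV, P'.onV_onV]
          exact ⟨Or.inr (Or.inl ⟨rfl, rfl⟩), Or.inl ⟨rfl, rfl⟩⟩
        · rw [hb, (P'.type.resolve_left fun h => h.1 hv).2, h.map_base, h'.map_base]
          exact ⟨Or.inr (Or.inr (Or.inl ⟨rfl, rfl⟩)), Or.inr (Or.inr (Or.inl ⟨rfl, rfl⟩))⟩
      rcases ho with ⟨rfl, rfl⟩ | ⟨rfl, rfl⟩ | ⟨rfl, rfl⟩ | ⟨rfl, rfl⟩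
      · exact Or.inl ⟨rfl, rfl⟩
      · exact htgt.1
      · rw [h.map_src, h'.map_src]; exact Or.inr (Or.inl ⟨rfl, rfl⟩)
      · change VertexRel c h d₀ c' h' d₀' t v (Γ.tgt (h.onD d₀)) (Γ'.tgt (h'.onD d₀'))
        rw [h.map_tgt, h'.map_tgt]; exact htgt.2
  have hrev : ∀ d e, EdgeRel c h d₀ c' h' d₀' t d e →
      EdgeRel c h d₀ c' h' d₀' t (Γ.rev d) (Γ'.rev e) := by
    rintro d e (⟨x, hx, he⟩ | ho)
    · refine Or.inl ⟨Δ.rev x, c.onD_rev hx, ?_⟩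
      rw [c'.onD_rev he, t.map_rev]
    · right
      rcases ho with ⟨rfl, rfl⟩ | ⟨rfl, rfl⟩ | ⟨rfl, rfl⟩ | ⟨rfl, rfl⟩ <;>
        simp [Γ.rev_rev, Γ'.rev_rev]
  obtain ⟨f, hf⟩ := GraphIso.exists_of_rel (VertexRel c h d₀ c' h' d₀' t v)
    (EdgeRel c h d₀ c' h' d₀' t) (P.existsUnique_vertexRel P' htv)
    (fun w => by
      simpa only [vertexRel_symm htv] using P'.existsUnique_vertexRel P (t := t.symm) htv' w)
    (P.existsUnique_edgeRel P')
    (fun e => by simpa only [edgeRel_symm] using P'.existsUnique_edgeRel P (t := t.symm) e)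
    hsrc hrev (Or.inr (Or.inr (Or.inl ⟨rfl, rfl⟩)))
  refine ⟨f, fun d => ?_⟩
  rcases hf d with ⟨x, hx, he⟩ | ho
  · rw [hx, he]; rfl
  · have h1 : d ∈ c.ker := (P.mem_ker_iff d).2 (by tauto)
    have h2 : f.onD d ∈ c'.ker := (P'.mem_ker_iff _).2 (by tauto)
    rw [Collapse.mem_ker.1 h1, Collapse.mem_ker.1 h2]; rfl

end IsLeafCollapse

section Trivalent

variable {Γ Δ : PGraph} {c : Collapse Γ Δ} {h : GraphIso Γ Γ} {k : GraphIso Δ Δ}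

lemma PGraph.not_three_of_valence_eq_two {u : Γ.V} (hu : Γ.valence u = 2) {a b e : Γ.D}
    (ha : Γ.src a = u) (hb : Γ.src b = u) (he : Γ.src e = u) (hab : a ≠ b) (hae : a ≠ e) :
    b = e := by
  have := Γ.finD
  by_contra hbe
  have h1 : ({a, b, e} : Set Γ.D).ncard = 3 := by
    rw [Set.ncard_eq_three]; exact ⟨a, b, e, hab, hae, hbe, rfl⟩
  have h2 : ({a, b, e} : Set Γ.D).ncard ≤ {d | Γ.src d = u}.ncard :=
    Set.ncard_le_ncard (by rintro x (rfl | rfl | rfl) <;> assumption) (Set.toFinite _)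
  have h3 : {d | Γ.src d = u}.ncard = Γ.valence u := rfl
  omega

lemma PGraph.exists_of_valence_eq_three {u : Γ.V} (hu : Γ.valence u = 3) {d : Γ.D}
    (hd : Γ.src d = u) : ∃ e₁ e₂, e₁ ≠ e₂ ∧ e₁ ≠ d ∧ e₂ ≠ d ∧ Γ.src e₁ = u ∧ Γ.src e₂ = u ∧
      ∀ e, Γ.src e = u → e ≠ d → e = e₁ ∨ e = e₂ := by
  have := Γ.finD
  have h1 : ({e | Γ.src e = u} \ {d}).ncard = 2 := by
    rw [Set.ncard_sdiff_singleton_of_mem (show d ∈ {e | Γ.src e = u} from hd)]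
    have h3 : {d | Γ.src d = u}.ncard = Γ.valence u := rfl
    omega
  obtain ⟨e₁, e₂, hne, hs⟩ := Set.ncard_eq_two.1 h1
  have h2 : e₁ ∈ {e | Γ.src e = u} \ {d} := hs ▸ by simp
  have h3 : e₂ ∈ {e | Γ.src e = u} \ {d} := hs ▸ by simp
  refine ⟨e₁, e₂, hne, h2.2, h3.2, h2.1, h3.1, fun e he hed => ?_⟩
  have h4 : e ∈ {e | Γ.src e = u} \ {d} := ⟨he, hed⟩
  rw [hs] at h4
  exact h4

/-- A minimal invariant forest that contains a leaf edge is the orbit of a leaf edge. -/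
lemma IsTrivalent.exists_isLeafCollapse (hT : IsTrivalent h) (hh : ∀ d, h.onD (h.onD d) = d)
    (hhV : ∀ u, h.onV (h.onV u) = u) (hfree : ∀ d, h.onD d ≠ d)
    (heD : ∀ d, c.onD (h.onD d) = (c.onD d).map k.onD)
    (heV : ∀ u, c.onV (h.onV u) = k.onV (c.onV u))
    (hmin : ∀ F, IsInvariantForest h F → F ⊆ c.ker → F.Nonempty → F = c.ker)
    {d : Γ.D} (hd : d ∈ c.ker) (hbad : IsLeafEdge h d) :
    ∃ v d₀, IsLeafCollapse c h k v d₀ := by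
  obtain ⟨d₀, hd₀, hbad⟩ : ∃ d₀ ∈ c.ker, h.onD d₀ = Γ.rev d₀ ∨ Γ.tgt d₀ = Γ.base := by
    rcases hbad with hb | hb | hb
    · exact ⟨d, hd, Or.inl hb⟩
    · exact ⟨Γ.rev d, c.isForest.1 d hd, Or.inr (by rw [tgt_rev, hb])⟩
    · exact ⟨d, hd, Or.inr hb⟩
  have hloop := c.isForest.src_ne_tgt hd₀
  have hflip : h.onD d₀ = Γ.rev d₀ → Γ.tgt d₀ = h.onV (Γ.src d₀) := fun hf => by
    rw [← h.map_src, hf]; rfl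
  have hsb : Γ.src d₀ ≠ Γ.base := by
    intro hb
    rcases hbad with hf | ht
    · exact hloop (by rw [hflip hf, hb, h.map_base])
    · exact hloop (by rw [hb, ht])
  have hhsb : h.onV (Γ.src d₀) ≠ Γ.base := fun hb =>
    hsb (h.onV.injective (hb.trans h.map_base.symm))
  have hsne : h.onV (Γ.src d₀) ≠ Γ.src d₀ := fun he => hsb (hT.eq_base _ he)
  have hinv := c.isInvariantForest_ker heD
  set O : Set Γ.D := {d | d = d₀ ∨ d = Γ.rev d₀ ∨ d = h.onD d₀ ∨ d = Γ.rev (h.onD d₀)} with hO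
  have hOk : O ⊆ c.ker := by
    rintro e (rfl | rfl | rfl | rfl)
    · exact hd₀
    · exact c.isForest.1 _ hd₀
    · exact (hinv.2 _).1 hd₀
    · exact c.isForest.1 _ ((hinv.2 _).1 hd₀)
  have hOh : ∀ e ∈ O, h.onD e ∈ O := by
    rintro e (rfl | rfl | rfl | rfl)
    · exact Or.inr (Or.inr (Or.inl rfl))
    · exact Or.inr (Or.inr (Or.inr (h.map_rev _).symm))
    · exact Or.inl (hh _)
    · exact Or.inr (Or.inl (by rw [← h.map_rev, hh]))
  have hOr : ∀ e ∈ O, Γ.rev e ∈ O := by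
    rintro e (rfl | rfl | rfl | rfl)
    · exact Or.inr (Or.inl rfl)
    · exact Or.inl (Γ.rev_rev _)
    · exact Or.inr (Or.inr (Or.inr rfl))
    · exact Or.inr (Or.inr (Or.inl (Γ.rev_rev _)))
  have hOker : O = c.ker := hmin O ⟨⟨hOr, fun u l hl ht hk =>
    c.isForest.2 u l hl ht fun e he => hOk (hk e he)⟩,
    fun e => ⟨hOh e, fun he => hh e ▸ hOh _ he⟩⟩ hOk ⟨d₀, Or.inl rfl⟩
  have hker : ∀ e, e ∈ c.ker ↔ e ∈ O := fun e => by rw [hOker]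
  set S : Set Γ.V := {u | u = Γ.src d₀ ∨ u = h.onV (Γ.src d₀) ∨ u = Γ.tgt d₀} with hS
  have htgtS : ∀ e ∈ c.ker, Γ.tgt e ∈ S := by
    intro e he
    rcases (hker e).1 he with rfl | rfl | rfl | rfl
    · exact Or.inr (Or.inr rfl)
    · exact Or.inl (tgt_rev _)
    · rw [h.map_tgt]
      rcases hbad with hf | hb
      · left; rw [hflip hf, hhV]
      · right; right; rw [hb, h.map_base]
    · rw [tgt_rev, h.map_src]; exact Or.inr (Or.inl rfl)
  have hsrcS : ∀ e ∈ c.ker, Γ.src e ∈ S := fun e he => by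
    have := htgtS _ (c.isForest.1 e he)
    rwa [tgt_rev] at this
  have hctgt : c.onV (Γ.src d₀) = c.onV (Γ.tgt d₀) := c.onV_src_of_mem_ker hd₀
  have hfib : ∀ u, c.onV u = c.onV (Γ.src d₀) ↔ u ∈ S := by
    refine fun u => ⟨fun hu => ?_, ?_⟩
    · exact Joined.mem_of_closed (fun e he _ => htgtS e he)
        ((c.onV_eq_iff_joined _ _).1 hu.symm) (Or.inl rfl)
    · rintro (rfl | rfl | rfl)
      · rfl
      · rcases hbad with hf | hb
        · rw [← hflip hf, hctgt]
        · rw [heV, hctgt, hb, c.map_base, k.map_base]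
      · exact hctgt.symm
  refine ⟨c.onV (Γ.src d₀), d₀, hker, hh, hhV, heD, heV, hsne, ?_, hfib, fun u u' hu hv => ?_,
    fun e he hv => ?_⟩
  · rcases hbad with hf | hb
    · refine Or.inl ⟨fun hb => ?_, hf⟩
      rw [← c.map_base] at hb
      rcases (hfib _).1 hb.symm with h1 | h1 | h1
      · exact hsb h1.symm
      · exact hhsb h1.symm
      · exact hhsb (by rw [← hflip hf, h1])
    · exact Or.inr ⟨by rw [hctgt, hb, c.map_base], hb⟩
  · refine (Joined.mem_of_closed (S := {u}) (fun e he hs => ?_)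
      ((c.onV_eq_iff_joined _ _).1 hu) rfl).symm
    exact absurd ((hfib u).2 (hs ▸ hsrcS e he)) hv
  · rcases (hfib _).1 hv with h1 | h1 | h1
    · exact Or.inl h1
    · exact Or.inr h1
    · rcases hbad with hf | hb
      · exact Or.inr (h1.trans (hflip hf))
      · -- The base has valence two, so all its edges are in the forest.
        exfalso
        have h2 : Γ.src (Γ.rev (h.onD d₀)) = Γ.base := by
          change Γ.tgt (h.onD d₀) = _
          rw [h.map_tgt, hb, h.map_base]
        have h3 := not_three_of_valence_eq_two hT.valence_base (a := Γ.rev d₀)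
          (b := Γ.rev (h.onD d₀)) (e := e) hb h2 (h1.trans hb)
          (fun h' => hfree d₀ (rev_injective h').symm)
          (fun h' => he ((hker e).2 (Or.inr (Or.inl h'.symm))))
        exact he ((hker e).2 (Or.inr (Or.inr (Or.inr h3.symm))))

/-- If no leaf edge is collapsed, or if `q` is not the image of the collapsed leaf edge, then a
fixed vertex `q` of the target is the base and has valence two. -/
lemma IsTrivalent.not_three_of_fiber (hT : IsTrivalent h) {q : Δ.V}
    (hfix : ∀ u, c.onV u = q → h.onV u = u) {x y z : Δ.D}
    (hx : Δ.src x = q) (hy : Δ.src y = q) (hz : Δ.src z = q) (hxy : x ≠ y) (hxz : x ≠ z) :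
    y = z := by
  have hsrc : ∀ {w : Δ.D} {d : Γ.D}, Δ.src w = q → c.onD d = some w → Γ.src d = Γ.base :=
    fun hw hd => hT.eq_base _ (hfix _ (by rw [← c.map_src _ _ hd, hw]))
  obtain ⟨a, ha⟩ := c.exists_onD x
  obtain ⟨b, hb⟩ := c.exists_onD y
  obtain ⟨e, he⟩ := c.exists_onD z
  have := not_three_of_valence_eq_two hT.valence_base (hsrc hx ha) (hsrc hy hb) (hsrc hz he)
    (fun hab => hxy (by subst hab; exact Option.some.inj (ha.symm.trans hb)))
    (fun hae => hxz (by subst hae; exact Option.some.inj (ha.symm.trans he)))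
  subst this
  exact Option.some.inj (hb.symm.trans he)

lemma IsLeafCollapse.fixed_of_ne {v : Δ.V} {d₀ : Γ.D} (P : IsLeafCollapse c h k v d₀) {q : Δ.V}
    (hq : k.onV q = q) (hv : q ≠ v) (u : Γ.V) (hu : c.onV u = q) : h.onV u = u :=
  P.inj _ _ (by rw [P.equivV, hu, hq]) (by rw [P.equivV, hu, hq]; exact hv)

lemma IsTrivalent.fixed_of_no_leafEdge (hT : IsTrivalent h)
    (hhV : ∀ u, h.onV (h.onV u) = u) (hinv : IsInvariantForest h c.ker)
    (heV : ∀ u, c.onV (h.onV u) = k.onV (c.onV u)) (hno : ∀ d ∈ c.ker, ¬ IsLeafEdge h d) {q : Δ.V}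
    (hq : k.onV q = q) (u : Γ.V) (hu : c.onV u = q) : h.onV u = u := by
  obtain ⟨l, hl, ht, hk⟩ := ((c.onV_eq_iff_joined u (h.onV u)).1
    (by rw [heV, hu, hq])).exists_isTaut
  by_cases hl0 : l = []
  · subst hl0; exact Eq.symm hl
  · obtain ⟨d, hd, hb⟩ := hinv.exists_flipped_or_fixed hhV hl ht hk hl0
    exact absurd (hb.imp id fun hb => Or.inr (hT.eq_base _ hb)) (hno d hd)

end Trivalent

end PalAut
namespace PalAut

open PGraph

variable {n : ℕ}

/-! ### The vertices of `L` and their ranks -/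

/-- If the target has only one pair of moved vertices less than the source, then there is no
invariant forest strictly between the empty one and the forest of the collapse. -/
lemma Collapse.eq_ker_of_numMoved {Γ Δ : PGraph} {c : Collapse Γ Δ} {h : GraphIso Γ Γ}
    {k : GraphIso Δ Δ} (hfree : ∀ d, h.onD d ≠ d) (hhV : ∀ u, h.onV (h.onV u) = u)
    (heD : ∀ d, c.onD (h.onD d) = (c.onD d).map k.onD)
    (heV : ∀ u, c.onV (h.onV u) = k.onV (c.onV u)) (hr : numMoved h ∅ ≤ numMoved k ∅ + 2)
    (F : Set Γ.D) (hF : IsInvariantForest h F) (hFc : F ⊆ c.ker) (hne : F.Nonempty) :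
    F = c.ker := by
  by_contra hc
  have h1 := numMoved_add_two_le hfree hhV hF (c.isInvariantForest_ker heD)
    (hFc.ssubset_of_ne hc)
  have h2 := numMoved_add_two_le hfree hhV (isInvariantForest_empty h) hF
    (Set.empty_ssubset.2 hne)
  rw [c.numMoved_ker heV] at h1
  omega

/-- If the same graph is obtained from two trivalent graphs by collapsing a leaf edge of the first
and by collapsing some orbit of edges of the second, then the two are related by an automorphism
which fixes all collapses of that graph.  The automorphism is needed because the edges at the image
of the leaf edge can be distributed to the two ends of the new edge in two ways, which differ by the
involution on a branch. -/
theorem exists_PiA_of_leafEdge {W Z Z' : MarkedGraph n} {k : GraphIso W.graph W.graph}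
    {h : GraphIso Z.graph Z.graph} {h' : GraphIso Z'.graph Z'.graph} (hk : Realizes W k)
    (hh : Realizes Z h) (hh' : Realizes Z' h') {c : Collapse Z.graph W.graph}
    {c' : Collapse Z'.graph W.graph} (hc : c.IsMarked) (hc' : c'.IsMarked) (hT : IsTrivalent h)
    (hT' : IsTrivalent h') (hr : numMoved h ∅ ≤ numMoved k ∅ + 2)
    (hr' : numMoved h' ∅ ≤ numMoved k ∅ + 2) {d : Z.graph.D} (hd : d ∈ c.ker)
    (hl : IsLeafEdge h d) :
    ∃ (g : PiA n) (t : GraphIso W.graph W.graph),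
      (∀ w, t.map (W.mark w) = W.mark ((g : MulAut (FreeGroup (Fin n))) w)) ∧
      (∀ x, t.onD x = x ∨ t.onD x = k.onD x) ∧
      (g : MulAut (FreeGroup (Fin n))) • Z.toSpine = Z'.toSpine := by
  obtain ⟨heD, heV⟩ := hc.equivariant hh hk
  obtain ⟨heD', heV'⟩ := hc'.equivariant hh' hk
  obtain ⟨v, d₀, P⟩ := hT.exists_isLeafCollapse hh.onD_onD hh.onV_onV hh.onD_ne heD heV
    (Collapse.eq_ker_of_numMoved hh.onD_ne hh.onV_onV heD heV hr) hd hl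
  have hPv : c.onV (Z.graph.src d₀) = v := (P.fiber _).2 (Or.inl rfl)
  have hkv : k.onV v = v := by
    rw [← hPv, ← P.equivV, hPv]; exact (P.fiber _).2 (Or.inr (Or.inl rfl))
  -- The two edges other than `d₀` at the trivalent vertex `src d₀`, and their images.
  obtain ⟨e₁, e₂, he12, he1, he2, hs1, hs2, hall⟩ :=
    exists_of_valence_eq_three (hT.valence_eq _ P.src_ne_base) (d := d₀) rfl
  have hkersrc : ∀ e ∈ c.ker, Z.graph.src e = Z.graph.src d₀ → e = d₀ := by
    intro e he hs
    rcases (P.mem_ker_iff e).1 he with rfl | rfl | rfl | rfl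
    · rfl
    · exact absurd hs.symm (c.isForest.src_ne_tgt ((P.mem_ker_iff d₀).2 (Or.inl rfl)))
    · rw [h.map_src] at hs; exact absurd hs P.src_ne
    · change Z.graph.tgt (h.onD d₀) = _ at hs
      rw [h.map_tgt] at hs
      rcases P.type with ⟨-, hf⟩ | ⟨-, hb⟩
      · rw [hf, Z.graph.rev_rev]
      · rw [hb, h.map_base] at hs; exact absurd hs.symm P.src_ne_base
  obtain ⟨x₁, hx1⟩ := Collapse.exists_of_notMem_ker fun he => he1 (hkersrc e₁ he hs1)
  obtain ⟨x₂, hx2⟩ := Collapse.exists_of_notMem_ker fun he => he2 (hkersrc e₂ he hs2)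
  have hxs1 : W.graph.src x₁ = v := by rw [c.map_src _ _ hx1, hs1, hPv]
  have hxs2 : W.graph.src x₂ = v := by rw [c.map_src _ _ hx2, hs2, hPv]
  have hx12 : x₁ ≠ x₂ := fun he => he12 (c.onD_inj hx1 (he ▸ hx2))
  have hkx1 : c.onD (h.onD e₁) = some (k.onD x₁) := by rw [heD, hx1]; rfl
  have hxk1 : x₁ ≠ k.onD x₁ := (hk.onD_ne x₁).symm
  have hxk2 : x₂ ≠ k.onD x₁ := by
    intro he
    have := c.onD_inj hkx1 (he ▸ hx2)
    rw [← this, h.map_src, hs1] at hs2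
    exact P.src_ne hs2
  have hxk2' : x₁ ≠ k.onD x₂ := fun he => hxk2 (by rw [he, hk.onD_onD])
  have hkxs1 : W.graph.src (k.onD x₁) = v := by rw [k.map_src, hxs1, hkv]
  -- The vertex `v` has too many edges for a vertex that is not the image of a leaf edge.
  have hnofix : ¬ ∀ u, c'.onV u = v → h'.onV u = u := fun hfix =>
    hxk2 (hT'.not_three_of_fiber hfix hxs1 hxs2 hkxs1 hx12 hxk1)
  obtain ⟨d', hd', hl'⟩ : ∃ d' ∈ c'.ker, IsLeafEdge h' d' := by
    by_contra hno
    push Not at hno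
    exact hnofix (hT'.fixed_of_no_leafEdge hh'.onV_onV (c'.isInvariantForest_ker heD') heV' hno hkv)
  obtain ⟨v', d₀', P'⟩ := hT'.exists_isLeafCollapse hh'.onD_onD hh'.onV_onV hh'.onD_ne heD' heV'
    (Collapse.eq_ker_of_numMoved hh'.onD_ne hh'.onV_onV heD' heV' hr') hd' hl'
  obtain rfl : v = v' := by
    by_contra hv
    exact hnofix (P'.fixed_of_ne hkv hv)
  obtain ⟨y₁, hy1⟩ := c'.exists_onD x₁
  obtain ⟨y₂, hy2⟩ := c'.exists_onD x₂
  have hsrc' : ∀ {d₀'}, IsLeafCollapse c' h' k v d₀' → ∀ {y x}, c'.onD y = some x →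
      W.graph.src x = v → Z'.graph.src y = Z'.graph.src d₀' ∨
        Z'.graph.src y = h'.onV (Z'.graph.src d₀') := fun P' y x hy hx =>
    P'.src_of_notMem_ker y (by rw [Collapse.mem_ker, hy]; simp) (by rw [← c'.map_src _ _ hy, hx])
  obtain ⟨d₀', P', hy1s⟩ : ∃ d₀', IsLeafCollapse c' h' k v d₀' ∧
      Z'.graph.src y₁ = Z'.graph.src d₀' := by
    rcases hsrc' P' hy1 hxs1 with hs | hs
    · exact ⟨d₀', P', hs⟩
    · exact ⟨_, P'.swap, by rw [hs, h'.map_src]⟩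
  have finish : ∀ t : GraphIso W.graph W.graph, (∀ x, t.onD (k.onD x) = k.onD (t.onD x)) →
      (∀ x, t.onD x = x ∨ t.onD x = k.onD x) → t.onV v = v →
      (∀ e, c'.onD e = some (t.onD x₁) → Z'.graph.src e = Z'.graph.src d₀') →
      (∀ e, c'.onD e = some (t.onD x₂) → Z'.graph.src e = Z'.graph.src d₀') →
      ∃ (g : PiA n) (t : GraphIso W.graph W.graph),
        (∀ w, t.map (W.mark w) = W.mark ((g : MulAut (FreeGroup (Fin n))) w)) ∧
        (∀ x, t.onD x = x ∨ t.onD x = k.onD x) ∧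
        (g : MulAut (FreeGroup (Fin n))) • Z.toSpine = Z'.toSpine := by
    intro t htk htx htv ht1 ht2
    have hmp : ∀ d e x, c.onD d = some x → c'.onD e = some (t.onD x) →
        Z.graph.src d = Z.graph.src d₀ → Z'.graph.src e = Z'.graph.src d₀' := by
      intro d e x hx he hs
      have hdd : d ≠ d₀ := by
        rintro rfl
        have := Collapse.mem_ker.1 ((P.mem_ker_iff d).2 (Or.inl rfl))
        rw [hx] at this; cases this
      rcases hall d hs hdd with rfl | rfl
      · rw [hx, Option.some.injEq] at hx1; subst hx1; exact ht1 e he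
      · rw [hx, Option.some.injEq] at hx2; subst hx2; exact ht2 e he
    obtain ⟨f, hf⟩ := P.exists_iso P' htv fun d e x hx he hv => by
      refine ⟨hmp d e x hx he, fun hs => ?_⟩
      refine (P.src_of_notMem_ker d (by rw [Collapse.mem_ker, hx]; simp) hv).resolve_right
        fun hs' => P'.src_ne ?_
      have h1 : c.onD (h.onD d) = some (k.onD x) := by rw [heD, hx]; rfl
      have h2 : c'.onD (h'.onD e) = some (t.onD (k.onD x)) := by rw [heD', he, htk]; rfl
      have h3 := hmp _ _ _ h1 h2 (by rw [h.map_src, hs', P.onV_onV])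
      rwa [h'.map_src, hs] at h3
    obtain ⟨g, hg⟩ := hk.exists_PiA htk
    exact ⟨g, t, hg, htx, smul_toSpine_eq hg hc hc' hf⟩
  rcases hsrc' P' hy2 hxs2 with hy2s | hy2s
  · refine finish (GraphIso.refl _) (fun _ => rfl) (fun _ => Or.inl rfl) rfl
      (fun e he => ?_) fun e he => ?_
    · rwa [c'.onD_inj he hy1]
    · rwa [c'.onD_inj he hy2]
  · obtain ⟨t, htk, htx, ht2, hfix⟩ := hk.exists_branchSwap (d := x₂) (by rw [hxs2, hkv])
    have ht1 : t.onD x₁ = x₁ := hfix x₁ (hxs1.trans hxs2.symm) hx12 hxk2'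
    have htv : t.onV v = v := by rw [← hxs1, ← t.map_src, ht1]
    refine finish t htk htx htv (fun e he => ?_) fun e he => ?_
    · rw [ht1] at he
      rwa [c'.onD_inj he hy1]
    · have h1 : c'.onD (h'.onD y₂) = some (t.onD x₂) := by rw [heD', hy2, ht2]; rfl
      rw [c'.onD_inj he h1, h'.map_src, hy2s, P'.onV_onV]

namespace LVertex

/-- A marked graph that represents a vertex of `L`. -/
noncomputable def model (x : LVertex n) : MarkedGraph n := x.2.2.choose

/-- The realization of `σ_n` on the marked graph `x.model`. -/
noncomputable def inv (x : LVertex n) : GraphIso x.model.graph x.model.graph :=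
  x.2.2.choose_spec.choose

lemma toSpine_model (x : LVertex n) : x.model.toSpine = x := x.2.2.choose_spec.choose_spec.1

lemma realizes_inv (x : LVertex n) : Realizes x.model x.inv :=
  x.2.2.choose_spec.choose_spec.2.1

/-- The rank of a vertex of `L`: the number of vertices of the graph that are moved by the
involution. -/
noncomputable def rank (x : LVertex n) : ℕ := numMoved x.inv ∅

lemma exists_collapse {x y : LVertex n} (h : Spine.Below (x : Spine n) y) :
    ∃ c : Collapse y.model.graph x.model.graph, c.IsMarked ∧ c.ker.Nonempty :=
  h.exists_collapse x.toSpine_model y.toSpine_model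

lemma rank_eq_numMoved_ker {x y : LVertex n} {c : Collapse y.model.graph x.model.graph}
    (hc : c.IsMarked) : numMoved y.inv c.ker = x.rank :=
  c.numMoved_ker (hc.equivariant y.realizes_inv x.realizes_inv).2

lemma isInvariantForest_ker {x y : LVertex n} {c : Collapse y.model.graph x.model.graph}
    (hc : c.IsMarked) : IsInvariantForest y.inv c.ker :=
  c.isInvariantForest_ker (hc.equivariant y.realizes_inv x.realizes_inv).1

lemma rank_add_two_le {x y : LVertex n} (h : Spine.Below (x : Spine n) y) :
    x.rank + 2 ≤ y.rank := by
  obtain ⟨c, hc, hne⟩ := exists_collapse h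
  rw [← rank_eq_numMoved_ker hc]
  exact numMoved_add_two_le y.realizes_inv.onD_ne y.realizes_inv.onV_onV
    (isInvariantForest_empty _) (isInvariantForest_ker hc) (Set.empty_ssubset.2 hne)

lemma rank_add_two_le_two_mul (x : LVertex n) : x.rank + 2 ≤ 2 * n :=
  (x.model.admissible.numMoved_empty_le x.realizes_inv.onD_onD x.realizes_inv.onD_ne
    (x.model.admissible.card_edges_le x.model.mark)).1

lemma isTrivalent (x : LVertex n) (hx : x.rank + 2 = 2 * n) : IsTrivalent x.inv := by
  obtain ⟨h1, h2, h3⟩ := (x.model.admissible.numMoved_empty_le x.realizes_inv.onD_onD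
    x.realizes_inv.onD_ne (x.model.admissible.card_edges_le x.model.mark)).2 hx
  exact ⟨h1, h2, h3⟩

lemma realizes_twist (g : PiA n) {M : MarkedGraph n} {h : GraphIso M.graph M.graph}
    (hr : Realizes M h) : Realizes (M.twist g) h := by
  intro w
  have h1 := DFunLike.congr_fun (mem_PiA_iff.1 ((PiA n).inv_mem g.2)) w
  exact (hr _).trans (congrArg (fun z => (M.mark z : M.graph.PathGroup)) h1)

lemma toSpine_twist (g : PiA n) (x : LVertex n) :
    (x.model.twist g).toSpine = (g • x : LVertex n) := by
  rw [← smul_toSpine, x.toSpine_model]; rfl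

lemma below_smul (g : PiA n) {x y : LVertex n} (h : Spine.Below (x : Spine n) y) :
    Spine.Below ((g • x : LVertex n) : Spine n) (g • y : LVertex n) := by
  obtain ⟨c, hc, d, hd⟩ := exists_collapse h
  exact ⟨_, _, toSpine_twist g x, toSpine_twist g y, c, ⟨d, hd⟩, fun w => hc _⟩

/-- The graph of `x` is obtained from the graph of `y` by a collapse of a forest that contains a
leaf edge. -/
def LeafBelow (x y : LVertex n) : Prop :=
  ∃ c : Collapse y.model.graph x.model.graph, c.IsMarked ∧ ∃ d ∈ c.ker, IsLeafEdge y.inv d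

lemma leafBelow_of_collapse {x y : LVertex n} {M N : MarkedGraph n} (hM : M.toSpine = x)
    (hN : N.toSpine = y) {h : GraphIso N.graph N.graph} (hr : Realizes N h)
    {c : Collapse N.graph M.graph} (hc : c.IsMarked) {d : N.graph.D} (hd : d ∈ c.ker)
    (hl : IsLeafEdge h d) : LeafBelow x y := by
  obtain ⟨a, ha⟩ := MarkedGraph.exists_iso (y.toSpine_model.trans hN.symm)
  obtain ⟨b, hb⟩ := MarkedGraph.exists_iso (hM.trans x.toSpine_model.symm)
  refine ⟨b.toCollapse.comp (c.comp a.toCollapse), (Collapse.isMarked_toCollapse hb).comp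
    (hc.comp (Collapse.isMarked_toCollapse ha)), a.onD.symm d, ?_, ?_⟩
  · rw [Collapse.mem_ker_comp, Collapse.mem_ker_comp]
    exact Or.inl (Or.inr ⟨d, hd, by simp [GraphIso.toCollapse]⟩)
  · have he : ∀ e, a.onD (y.inv.onD e) = h.onD (a.onD e) := fun e => Option.some.inj
      (((Collapse.isMarked_toCollapse ha).equivariant y.realizes_inv hr).1 e)
    rcases hl with hl | hl | hl
    · left
      refine a.onD.injective ?_
      rw [he, ← a.map_rev, Equiv.apply_symm_apply, hl]
    · right; left
      refine a.onV.injective ?_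
      rw [← a.map_src, a.map_base, Equiv.apply_symm_apply, hl]
    · right; right
      refine a.onV.injective ?_
      rw [← a.map_tgt, a.map_base, Equiv.apply_symm_apply, hl]

lemma LeafBelow.smul (g : PiA n) {x y : LVertex n} (h : LeafBelow x y) :
    LeafBelow (g • x) (g • y) := by
  obtain ⟨c, hc, d, hd, hl⟩ := h
  exact leafBelow_of_collapse (toSpine_twist g x) (toSpine_twist g y)
    (realizes_twist g y.realizes_inv) (c := c) (fun w => hc _) hd hl

lemma not_leafBelow_self (x : LVertex n) : ¬ LeafBelow x x := by
  rintro ⟨c, hc, d, hd, -⟩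
  have : (GraphIso.refl x.model.graph).toCollapse.IsMarked :=
    Collapse.isMarked_toCollapse fun w => GraphIso.map_refl _
  rw [hc.ker_eq this] at hd
  cases hd

lemma isLeafEdge_rev {Γ : PGraph} {h : GraphIso Γ Γ} {d : Γ.D} (hl : IsLeafEdge h d) :
    IsLeafEdge h (Γ.rev d) := by
  rcases hl with hl | hl | hl
  · left; rw [← h.map_rev, hl]
  · right; right; rw [tgt_rev, hl]
  · right; left; exact hl

lemma isLeafEdge_map {Γ : PGraph} {h : GraphIso Γ Γ} {d : Γ.D} (hl : IsLeafEdge h d) :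
    IsLeafEdge h (h.onD d) := by
  rcases hl with hl | hl | hl
  · left; rw [hl, ← h.map_rev, hl]
  · right; left; rw [h.map_src, hl, h.map_base]
  · right; right; rw [h.map_tgt, hl, h.map_base]

/-- Between `w` and `y` there is at most one vertex of the next higher rank such that the last
orbit of edges that is collapsed consists of leaf edges, but the ones before do not: its forest
consists of all edges that are not leaf edges. -/
lemma eq_of_leafBelow {w z z' y : LVertex n} (hwz : Spine.Below (w : Spine n) z)
    (hwz' : Spine.Below (w : Spine n) z') (hzy : Spine.Below (z : Spine n) y)
    (hzy' : Spine.Below (z' : Spine n) y) (hr : z.rank = w.rank + 2) (hr' : z'.rank = w.rank + 2)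
    (hw : LeafBelow w y) (hz : ¬ LeafBelow z y) (hz' : ¬ LeafBelow z' y) : z = z' := by
  obtain ⟨c, hc, d, hd, hl⟩ := hw
  have hinv := isInvariantForest_ker hc
  set F : Set y.model.graph.D := {e ∈ c.ker | ¬ IsLeafEdge y.inv e} with hF
  have hFinv : IsInvariantForest y.inv F := by
    refine ⟨⟨fun e he => ⟨hinv.1.1 e he.1, fun hle => he.2 ?_⟩, fun u l hl' ht hk =>
      hinv.1.2 u l hl' ht fun e he => (hk e he).1⟩, fun e => ?_⟩
    · have := isLeafEdge_rev hle
      rwa [y.model.graph.rev_rev] at this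
    · refine and_congr (hinv.2 e) (not_congr ⟨isLeafEdge_map, fun hle => ?_⟩)
      have := isLeafEdge_map hle
      rwa [y.realizes_inv.onD_onD] at this
  have hFc : F ⊂ c.ker := Set.ssubset_iff_exists.2 ⟨fun e he => he.1, d, hd, fun he => he.2 hl⟩
  have key : ∀ {z : LVertex n}, Spine.Below (w : Spine n) z → z.rank = w.rank + 2 →
      ¬ LeafBelow z y → ∀ a : Collapse y.model.graph z.model.graph, a.IsMarked → a.ker = F := by
    intro z hwz hr hz a ha
    obtain ⟨b, hb, -⟩ := exists_collapse hwz
    have hker := (hb.comp ha).ker_eq hc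
    have hsub : a.ker ⊆ F := fun e he =>
      ⟨hker ▸ Collapse.mem_ker_comp.2 (Or.inl he), fun hle => hz ⟨a, ha, e, he, hle⟩⟩
    by_contra hne
    have h1 := numMoved_add_two_le y.realizes_inv.onD_ne y.realizes_inv.onV_onV
      (isInvariantForest_ker ha) hFinv (hsub.ssubset_of_ne hne)
    have h2 := numMoved_add_two_le y.realizes_inv.onD_ne y.realizes_inv.onV_onV hFinv hinv hFc
    rw [rank_eq_numMoved_ker ha] at h1
    rw [rank_eq_numMoved_ker hc] at h2
    omega
  obtain ⟨a, ha, -⟩ := exists_collapse hzy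
  obtain ⟨a', ha', -⟩ := exists_collapse hzy'
  refine Subtype.ext ?_
  rw [← z.toSpine_model, ← z'.toSpine_model]
  exact ha.toSpine_eq_of_ker_eq ha' ((key hwz hr hz a ha).trans (key hwz' hr' hz' a' ha').symm)

/-- A maximal invariant forest of a trivalent graph contains a leaf edge. -/
lemma leafBelow_of_rank_eq_zero {x y : LVertex n} (h : Spine.Below (x : Spine n) y)
    (hx : x.rank = 0) (hy : y.rank + 2 = 2 * n) : LeafBelow x y := by
  have := y.model.graph.finV
  obtain ⟨c, hc, -⟩ := exists_collapse h
  have hT := y.isTrivalent hy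
  have hinv := isInvariantForest_ker hc
  have h0 := rank_eq_numMoved_ker hc
  rw [hx, numMoved, Set.ncard_eq_zero (Set.toFinite _)] at h0
  have hpos : y.rank ≠ 0 := by have := rank_add_two_le h; omega
  rw [rank, numMoved_empty, ← Nat.pos_iff_ne_zero, Set.ncard_pos (Set.toFinite _)] at hpos
  obtain ⟨u, hu⟩ := hpos
  have hj : y.model.graph.Joined c.ker u (y.inv.onV u) := by
    by_contra hj
    have : y.model.graph.component c.ker u ∈ movedComponents y.inv c.ker := ⟨u, hj, rfl⟩
    rw [h0] at this
    exact this
  obtain ⟨l, hl, ht, hk⟩ := hj.exists_isTaut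
  obtain ⟨d, hd, hb⟩ := hinv.exists_flipped_or_fixed y.realizes_inv.onV_onV hl ht hk (by
    rintro rfl
    exact hu (Eq.symm hl))
  exact ⟨c, hc, d, hd, hb.imp id fun hb => Or.inr (hT.eq_base _ hb)⟩

/-- If `z` and `z'` have the largest rank, `w` the rank below, and `z` collapses to `w` by a leaf
edge, then `z` and `z'` are related by an element of the group that fixes everything
below `w`. -/
lemma exists_smul_eq {w z z' : LVertex n}
    (hwz' : Spine.Below (w : Spine n) z') (hr : z.rank = w.rank + 2) (hr' : z'.rank = w.rank + 2)
    (hz : z.rank + 2 = 2 * n) (hl : LeafBelow w z) :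
    ∃ g : PiA n, g • z = z' ∧ g • w = w ∧ ∀ x : LVertex n, Spine.Below (x : Spine n) w →
      g • x = x := by
  obtain ⟨c, hc, d, hd, hle⟩ := hl
  obtain ⟨c', hc', -⟩ := exists_collapse hwz'
  obtain ⟨g, t, hg, ht, hgz⟩ := exists_PiA_of_leafEdge w.realizes_inv z.realizes_inv
    z'.realizes_inv hc hc' (z.isTrivalent hz) (z'.isTrivalent (by omega)) hr.le hr'.le hd hle
  rw [z.toSpine_model, z'.toSpine_model] at hgz
  have key : ∀ (x : LVertex n) (b : Collapse w.model.graph x.model.graph), b.IsMarked →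
      g • x = x := by
    intro x b hb
    have hinv := isInvariantForest_ker hb
    have := smul_toSpine_eq_self hg hb fun e => by
      rcases ht e with he | he
      · rw [he]
      · rw [he]; exact (hinv.2 e).symm
    rw [x.toSpine_model] at this
    exact Subtype.ext this
  refine ⟨g, Subtype.ext hgz, ?_, fun x hx => ?_⟩
  · exact key w (GraphIso.refl _).toCollapse
      (Collapse.isMarked_toCollapse fun _ => GraphIso.map_refl _)
  · obtain ⟨b, hb, -⟩ := exists_collapse hx
    exact key x b hb

end LVertex

end PalAut
namespace PalAut

open LVertex

/-! ### The matching of top simplices with their faces -/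

namespace LSimplex

variable {n k : ℕ}

lemma rank_add_le (s : LSimplex n k) (d : ℕ) : ∀ {i j : Fin (k + 1)}, (j : ℕ) = i + d →
    (s.1 i).rank + 2 * d ≤ (s.1 j).rank := by
  induction d with
  | zero => intro i j h; rw [show j = i from Fin.ext h]; omega
  | succ d ih =>
    intro i j h
    have h1 := ih (i := i) (j := ⟨i + d, by omega⟩) rfl
    have h2 := rank_add_two_le (s.2 ⟨i + d, by omega⟩ j (by rw [Fin.lt_def]; simp only; omega))
    omega

/-- A simplex of the largest dimension has vertices of all ranks. -/
lemma rank_eq_two_mul (s : LSimplex (k + 2) (k + 1)) (j : Fin (k + 2)) :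
    (s.1 j).rank = 2 * j := by
  have h1 := s.rank_add_le j (i := 0) (j := j) (by simp)
  have h2 := s.rank_add_le (k + 1 - j) (i := j) (j := Fin.last _) (by simp; omega)
  have h3 := (s.1 (Fin.last _)).rank_add_two_le_two_mul
  omega

/-- The translate of a simplex by a group element. -/
def smul (g : PiA n) (s : LSimplex n k) : LSimplex n k :=
  ⟨fun i => g • s.1 i, fun i j h => below_smul g (s.2 i j h)⟩

/-- The collapse from the last vertex to the vertex with index `j` involves a leaf edge. -/
def Leaf (s : LSimplex n k) (j : Fin (k + 1)) : Prop := LeafBelow (s.1 j) (s.1 (Fin.last k))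

lemma Leaf.smul (g : PiA n) {s : LSimplex n k} {j : Fin (k + 1)} (h : s.Leaf j) :
    (s.smul g).Leaf j := LeafBelow.smul g h

lemma Leaf.of_smul (g : PiA n) {s : LSimplex n k} {j : Fin (k + 1)} (h : (s.smul g).Leaf j) :
    s.Leaf j := by
  have := h.smul g⁻¹
  have heq : (s.smul g).smul g⁻¹ = s := Subtype.ext (funext fun i => inv_smul_smul g (s.1 i))
  rwa [heq] at this

lemma leaf_zero (s : LSimplex (k + 2) (k + 1)) : s.Leaf 0 :=
  leafBelow_of_rank_eq_zero (s.2 _ _ (Fin.lt_def.2 (by simp))) (by rw [rank_eq_two_mul]; rfl)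
    (by rw [rank_eq_two_mul]; simp; ring)

lemma not_leaf_last (s : LSimplex n k) : ¬ s.Leaf (Fin.last k) := not_leafBelow_self _

/-- A top simplex is determined up to the group by the face opposite to the first vertex whose
collapse does not involve a leaf edge, among the simplices for which the collapse to the vertex
opposite to that face does not involve a leaf edge. -/
lemma exists_smul_eq_of_face_eq {s s' : LSimplex (k + 2) (k + 1)} {m : Fin (k + 1)}
    (h : s.face m.succ = s'.face m.succ) (h1 : s.Leaf m.castSucc) (h2 : ¬ s.Leaf m.succ)
    (h3 : ¬ s'.Leaf m.succ) : ∃ g : PiA (k + 2), ∀ j, g • s.1 j = s'.1 j := by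
  have hne : ∀ j, j ≠ m.succ → s.1 j = s'.1 j := by
    intro j hj
    obtain ⟨i, rfl⟩ := Fin.exists_succAbove_eq hj
    exact congrFun (congrArg Subtype.val h) i
  have hlt : m.castSucc < m.succ := Fin.castSucc_lt_succ
  have hw := hne m.castSucc hlt.ne
  have hr : ∀ s : LSimplex (k + 2) (k + 1), (s.1 m.succ).rank = (s.1 m.castSucc).rank + 2 :=
    fun s => by rw [rank_eq_two_mul, rank_eq_two_mul]; simp; ring
  by_cases hm : m.succ = Fin.last (k + 1)
  · have h1' : LeafBelow (s.1 m.castSucc) (s.1 m.succ) := by rw [hm]; exact h1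
    obtain ⟨g, hg, hgw, hgx⟩ := exists_smul_eq (z' := s'.1 m.succ) (hw ▸ s'.2 _ _ hlt) (hr s)
      (by rw [hr s', hw]) (by rw [rank_eq_two_mul, hm]; simp; ring) h1'
    refine ⟨g, fun j => ?_⟩
    by_cases hj : j = m.succ
    · rw [hj, hg]
    rw [← hne j hj]
    by_cases hj' : j = m.castSucc
    · rw [hj', hgw]
    · refine hgx _ (s.2 _ _ ?_)
      rw [Fin.lt_def]
      rw [Fin.ext_iff] at hj hj'
      have h4 := congrArg Fin.val hm
      simp at *
      omega
  · have hml : m.succ < Fin.last (k + 1) := lt_of_le_of_ne (Fin.le_last _) hm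
    have hy := hne _ hml.ne'
    have hz := eq_of_leafBelow (s.2 _ _ hlt) (hw ▸ s'.2 _ _ hlt) (s.2 _ _ hml)
      (hy ▸ s'.2 _ _ hml) (hr s) (by rw [hr s', hw]) h1 h2 (by rw [hy]; exact h3)
    refine ⟨1, fun j => ?_⟩
    rw [one_smul]
    by_cases hj : j = m.succ
    · rw [hj, hz]
    · exact hne j hj

end LSimplex

namespace QSimplex

variable {n k : ℕ}

/-- The condition `LSimplex.Leaf` for the orbits of simplices. -/
def Leaf (q : QSimplex n k) (j : Fin (k + 1)) : Prop := (Quotient.out q).Leaf j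

lemma face_mk_eq {i j : Fin (k + 2)} {s s' : LSimplex n (k + 1)}
    (h : QSimplex.face i (Quotient.mk _ s) = QSimplex.face j (Quotient.mk _ s')) :
    ∃ g : PiA n, (s.smul g).face i = s'.face j := by
  obtain ⟨g, hg⟩ := Quotient.exact h
  exact ⟨g, Subtype.ext (funext hg)⟩

/-- The faces of top simplices are distinguished by the ranks of their vertices. -/
lemma index_eq_of_face_eq {i j : Fin (k + 2)} {q q' : QSimplex (k + 2) (k + 1)}
    (h : q.face i = q'.face j) : i = j := by
  rw [← Quotient.out_eq q, ← Quotient.out_eq q'] at h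
  obtain ⟨g, hg⟩ := face_mk_eq h
  refine Fin.succAbove_left_injective (funext fun l => ?_)
  have h1 := congrArg (fun s : LSimplex (k + 2) k => (s.1 l).rank) hg
  have h2 := LSimplex.rank_eq_two_mul ((Quotient.out q).smul g) (i.succAbove l)
  have h3 := LSimplex.rank_eq_two_mul (Quotient.out q') (j.succAbove l)
  have h4 : 2 * (i.succAbove l : ℕ) = 2 * (j.succAbove l : ℕ) := by rw [← h2, ← h3]; exact h1
  exact Fin.ext (by omega)

lemma eq_of_face_eq {q q' : QSimplex (k + 2) (k + 1)} {m : Fin (k + 1)}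
    (h : q.face m.succ = q'.face m.succ) (h1 : q.Leaf m.castSucc) (h2 : ¬ q.Leaf m.succ)
    (h3 : ¬ q'.Leaf m.succ) : q = q' := by
  have h' := h
  rw [← Quotient.out_eq q, ← Quotient.out_eq q'] at h'
  obtain ⟨g, hg⟩ := face_mk_eq h'
  obtain ⟨g', hg'⟩ := LSimplex.exists_smul_eq_of_face_eq hg (h1.smul g)
    (fun hc => h2 (hc.of_smul g)) h3
  rw [← Quotient.out_eq q, ← Quotient.out_eq q']
  exact Quotient.sound ⟨g' * g, fun j => by rw [mul_smul]; exact hg' j⟩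

end QSimplex

/-- Every cochain of the top dimension is a coboundary: this is shown by induction for the cochains
that are supported on the simplices for which the first `m` vertices involve a leaf edge. -/
theorem coboundary_surjective (R : Type) [CommRing R] (k : ℕ) :
    Function.Surjective (coboundary (k + 2) R k) := by
  classical
  have key : ∀ m : Fin (k + 2), ∀ c : QSimplex (k + 2) (k + 1) → R, (∀ q, ¬ q.Leaf m → c q = 0) →
      ∃ b, coboundary (k + 2) R k b = c := by
    intro m
    induction m using Fin.reverseInduction with
    | last =>
      intro c hc
      exact ⟨0, by rw [map_zero]; funext q; exact (hc q (LSimplex.not_leaf_last _)).symm⟩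
    | cast m ih =>
      intro c hc
      let P (τ : QSimplex (k + 2) k) (q : QSimplex (k + 2) (k + 1)) : Prop :=
        q.Leaf m.castSucc ∧ ¬ q.Leaf m.succ ∧ q.face m.succ = τ
      let b : QSimplex (k + 2) k → R := fun τ =>
        if h : ∃ q, P τ q then (-1) ^ (m.succ : ℕ) * c h.choose else 0
      obtain ⟨b', hb'⟩ := ih (c - coboundary (k + 2) R k b) (by
        intro q hq
        have hother : ∀ i, i ≠ m.succ → b (q.face i) = 0 := fun i hi => by
          refine dif_neg ?_
          rintro ⟨q', -, -, h3⟩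
          exact hi (QSimplex.index_eq_of_face_eq h3).symm
        have hsum : coboundary (k + 2) R k b q = (-1) ^ (m.succ : ℕ) * b (q.face m.succ) := by
          change ∑ i : Fin (k + 2), (-1) ^ (i : ℕ) * b (q.face i) = _
          refine Finset.sum_eq_single _ (fun i _ hi => ?_) (by simp)
          rw [hother i hi, mul_zero]
        rw [Pi.sub_apply, hsum]
        by_cases hex : ∃ q', P (q.face m.succ) q'
        · obtain ⟨h1, h2, h3⟩ := hex.choose_spec
          have hb : b (q.face m.succ) = (-1) ^ (m.succ : ℕ) * c hex.choose := dif_pos hex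
          rw [hb, QSimplex.eq_of_face_eq h3 h1 h2 hq, ← mul_assoc, ← mul_pow]
          simp
        · have hb : b (q.face m.succ) = 0 := dif_neg hex
          rw [hb, mul_zero, sub_zero]
          exact hc q fun hl => hex ⟨q, hl, hq, rfl⟩)
      exact ⟨b' + b, by rw [map_add, hb', sub_add_cancel]⟩
  intro c
  exact key 0 c fun q hq => absurd (LSimplex.leaf_zero _) hq

end PalAut

theorem theoremc14 (n : ℕ) (hn : 2 ≤ n) (p : ℕ) [Fact p.Prime] (hp : Odd p) :
    Subsingleton (PalAut.QCohomology n (PalAut.ZLocal p) (n - 1)) := by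
  obtain ⟨k, rfl⟩ := Nat.exists_eq_add_of_le' hn
  change Subsingleton (PalAut.QCohomology (k + 2) (PalAut.ZLocal p) (k + 1))
  rw [Submodule.Quotient.subsingleton_iff, Submodule.submoduleOf_eq_top]
  intro c _
  exact LinearMap.mem_range.2 (PalAut.coboundary_surjective _ k c)
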